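/- **Setting.** Write poses as $g=(p,R)\in SE(3)=\mathbb R^3\times SO(3)$ and body velocities as $V=(v,\omega)\in\mathbb R^6$, with $4\times4$ matrix $\hat V\in se(3)$. Let $\mathrm{Ad}_g=\begin{bmatrix}R&\hat pR\\0&R\end{bmatrix}$, $\mathrm{Ad}_R=\mathrm{diag}(R,R)$ and $\mathrm{vec}(g)=\big(p,((R-R^\top)/2)^\vee\big)\in\mathbb R^6$. A vector form of $g$ is $\check g=(p,\xi\theta)$ where $R$ is the rotation about the unit vector $\xi$ by $\theta$, $|\theta|\le\pi$. Let $D\subset\mathbb R^3$ be compact and $\mathcal X=D\times SO(3)$; the poses in $\mathcal X$ are also identified with their vector forms. *Target.* There are finitely many motion profiles $V_\psi$, $\psi\in\Psi=\{1,\dots,\bar M\}$, which are functions of the pose with values in $\mathbb R^6$, and the active one is given by a known switching signal $s:[0,\infty)\to\Psi$ with finitely many switches in finite time. For each $\psi$ let $k_\psi(x,x')=\sigma_{f,\psi}^2\exp(-\tfrac12(x-x')^\top\Lambda_\psi(x-x'))$. Each output $[V_\psi]_i$, $i=1,\dots,6$, as a function of the vector form in $\mathcal X$, lies in the reproducing kernel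 Hilbert space of $k_\psi$ on $\mathcal X$, with norm $B_{\psi,i}$. *Model.* The data are $y^{\{j\}}=V_\psi(x^{\{j\}})+\epsilon^{\{j\}}_\psi$, $j=1,\dots,M_\psi$, with inputs $x^{\{j\}}\in\mathcal X$ and noise components that, for each output $i$, are independent over $j$ and sub-Gaussian with variance proxy $\sigma_{n,\psi,i}^2>0$ (for instance $\mathcal N(0,\sigma_{n,\psi,i}^2)$). Let $\mu_\psi$ and $\Sigma_\psi=\mathrm{diag}(\sigma_{\psi,1}^2,\dots,\sigma_{\psi,6}^2)$ be the Gaussian process posterior mean and variance. For $\delta\in(0,1)$ let $[\beta_\psi]_i=\sqrt{2B_{\psi,i}^2+300\,[\gamma_\psi]_i\log^3((M_\psi+1)/\delta)}$, where $[\gamma_\psi]_i=\sup\tfrac12\log\det(I+\sigma_{n,\psi,i}^{-2}K_\psi)$ is the maximum information gain, the supremum being over the Gram matrices $K_\psi$ of $M_\psi$ points of $\mathcal X$. *Closed loop.* Target, camera and observer obey $\dot g_{wo}=g_{wo}\hat V_{s(t)}(g_{wo})$, $\dot g_{wc}=g_{wc}\hat V_{wc}$ and $\dot{\bar g}_{co}=-\hat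 V_{wc}\bar g_{co}-\bar g_{co}\hat u_e$ (poses continuous, equations valid except at the switching times). Put $g_{co}=g_{wc}^{-1}g_{wo}$, $\bar g_{wo}=g_{wc}\bar g_{co}$, $g_{ce}=g_d^{-1}\bar g_{co}$ with a fixed desired pose $g_d$, $g_{ee}=\bar g_{co}^{-1}g_{co}$, $e_c=\mathrm{vec}(g_{ce})$, $e_e=\mathrm{vec}(g_{ee})$, $e=(e_c,e_e)$, $u_c=-\mathrm{Ad}_{g_d^{-1}}V_{wc}$. The input $u=(u_c,u_e)$ is $$u=-KNe-\begin{bmatrix}\mathrm{Ad}_{R_{ce}}\\ I\end{bmatrix}\mathrm{Ad}_{R_{ee}}\,\mu_{s(t)}(\check{\bar g}_{wo}),\qquad N=\begin{bmatrix}I&0\\-\mathrm{Ad}_{R_{ce}^{\top}}&I\end{bmatrix},\quad K=\mathrm{diag}(K_c,K_e),$$ with symmetric $K_c,K_e\in\mathbb R^{6\times6}$. Let $\lambda_K$ be the smallest eigenvalue of $N^\top KN$, that is, its infimum over all $R_{ce}$ with rotation angle $|\theta_{ce}|<\pi/2$, and let $S=\tfrac12\sum_{j\in\{c,e\}}\big(\|p_{je}\|^2+\mathrm{tr}(I-R_{je})\big)$.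 *Assumptions on the motion.* $g_{wo},\bar g_{wo}\in\mathcal X$; $|\theta_{ce}|<\pi/2$ and $|\theta_{ee}|<\pi/2$; and the rotation axis is known and fixed: the orientations of $g_{wo}$ and $\bar g_{wo}$ are rotations about one fixed unit vector $\xi$. **Claim.** (0) For every $\psi$ there is $L_\psi>0$ with $$\|V_\psi(g)-V_\psi(\bar g)\|\le L_\psi\|\mathrm{vec}(\bar g^{-1}g)\|\qquad(\ast)$$ for all $g,\bar g\in\mathcal X$ whose orientations are rotations about $\xi$ and for which the rotation angle of $\bar g^{-1}g$ is less than $\pi/2$ in absolute value. Moreover there are events $\Omega_\psi$ with $\mathbb P(\Omega_\psi)\ge1-\delta^6$ ($\psi\in\Psi$) such that the following holds for all $L_\psi\ge0$ with $(\ast)$ and $\tilde\lambda_{K,\psi}:=\lambda_K-L_\psi>0$ ($\psi\in\Psi$). Put $$c(\Sigma_\psi)=\frac{\|\beta_\psi^\top\Sigma_\psi^{1/2}\|}{2\tilde\lambda_{K,\psi}},\qquad E_\psi=\sqrt{\|e_c\|^2+\tfrac{\tilde\lambda_{K,\psi}}{\lambda_K}\big(\|e_e\|-c(\Sigma_\psi)\big)^2}-\sqrt{\tfrac{\tilde\lambda_{K,\psi}}{\lambda_K}}\;c(\Sigma_\psi),$$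 with $\Sigma_\psi$ evaluated at $\check{\bar g}_{wo}$, and call $\mathbb B_\psi=\{E_\psi\le0\}$ the ellipse. 1. For every outcome of the noise, $\|e\|$ is uniformly ultimately bounded: there is $b>0$ such that for every $a>0$ there is $T\ge0$ such that for all switching signals and all closed-loop motions that satisfy the assumptions at all times, and all $t_0\ge0$, $\|e(t_0)\|\le a$ implies $\|e(t)\|\le b$ for all $t\ge t_0+T$. 2. On $\Omega_\psi$, $\dot S<0$ at every time $t$, not a switching time, at which $s(t)=\psi$, the assumptions hold and the state is outside $\mathbb B_\psi$. 3. Let $\Phi\subset\Psi$ and consider an outcome in $\bigcap_{\psi\in\Phi}\Omega_\psi$. The error converges to the ellipses in the following sense, for all closed-loop motions that satisfy the assumptions at all times and have $s(t)\in\Phi$ for all $t$: (a) for all $\varepsilon,a>0$ there is $T\ge0$ such that $\|e(t_0)\|\le a$ implies $E_{s(t)}\le\varepsilon$ at some $t\in[t_0,t_0+T]$; (b) if $S<\ell$ on all ellipses $\mathbb B_\psi$, $\psi\in\Phi$ (for $\Sigma_\psi$ evaluated at any point of $\mathcal X$, and all error poses with angles at most $\pi/2$), then for every $a>0$ there is $T\ge0$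 such that $\|e(t_0)\|\le a$ implies $S(t)\le\ell$ for all $t\ge t_0+T$. Apart from the gain margin $\tilde\lambda_{K,\psi}$ and the confidence vector $\beta_\psi$, the size $c(\Sigma_\psi)$ of the ellipse thus depends only on the Gaussian process variance. -/

import Mathlib

open MeasureTheory ProbabilityTheory
open scoped Matrix NNReal

noncomputable section

namespace VisualPursuit

/-! ### Vectors and matrices -/

/-- Indices of `ℝ⁶ = ℝ³ × ℝ³`: `Sum.inl` is the translational part, `Sum.inr` the rotational one. -/
abbrev I6 : Type := Fin 3 ⊕ Fin 3

/-- Vectors of `ℝ⁶`. -/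
abbrev Vec6 : Type := I6 → ℝ

/-- The Euclidean norm of a coordinate vector. -/
def vnorm {ι : Type*} [Fintype ι] (v : ι → ℝ) : ℝ :=
  ‖(WithLp.toLp 2 v : EuclideanSpace ℝ ι)‖

/-- The wedge operator on `ℝ³`. -/
def hat (a : Fin 3 → ℝ) : Matrix (Fin 3) (Fin 3) ℝ :=
  !![0, -a 2, a 1; a 2, 0, -a 0; -a 1, a 0, 0]

theorem hat_mulVec (a b : Fin 3 → ℝ) : hat a *ᵥ b = crossProduct a b := by
  ext i
  fin_cases i <;> simp [hat, cross_apply, Matrix.mulVec, dotProduct, Fin.sum_univ_three] <;> ring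

/-- The vee operator, inverse of the wedge operator on skew-symmetric matrices. -/
def vee (A : Matrix (Fin 3) (Fin 3) ℝ) : Fin 3 → ℝ := ![A 2 1, A 0 2, A 1 0]

/-- The smallest eigenvalue of a real symmetric matrix. -/
def minEig {ι : Type*} [Fintype ι] [DecidableEq ι] (A : Matrix ι ι ℝ) : ℝ :=
  sInf (spectrum ℝ A)

/-! ### Rotations and poses -/

/-- The rotation group `SO(3)`. -/
abbrev SO3 : Type := Matrix.specialOrthogonalGroup (Fin 3) ℝ

/-- Rodrigues' formula: the matrix of the rotation about `η / ‖η‖` by the angle `‖η‖`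
(the identity for `η = 0`). -/
def rodrigues (η : Fin 3 → ℝ) : Matrix (Fin 3) (Fin 3) ℝ :=
  1 + (Real.sin (vnorm η) / vnorm η) • hat η
    + ((1 - Real.cos (vnorm η)) / vnorm η ^ 2) • (hat η * hat η)

theorem vnorm_sq_three (η : Fin 3 → ℝ) : vnorm η ^ 2 = η 0 ^ 2 + η 1 ^ 2 + η 2 ^ 2 := by
  rw [vnorm, EuclideanSpace.norm_sq_eq]
  simp [Fin.sum_univ_three]

theorem rodrigues_mem (η : Fin 3 → ℝ) :
    rodrigues η ∈ Matrix.specialOrthogonalGroup (Fin 3) ℝ := by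
  by_cases h0 : vnorm η = 0
  · have : rodrigues η = 1 := by simp [rodrigues, h0]
    rw [this]; exact one_mem _
  obtain ⟨s, hs⟩ : ∃ s, s = Real.sin (vnorm η) / vnorm η := ⟨_, rfl⟩
  obtain ⟨c, hc⟩ : ∃ c, c = (1 - Real.cos (vnorm η)) / vnorm η ^ 2 := ⟨_, rfl⟩
  have key : 2 * c - s ^ 2 - c ^ 2 * (η 0 ^ 2 + η 1 ^ 2 + η 2 ^ 2) = 0 := by
    rw [← vnorm_sq_three, hs, hc]
    field_simp
    linear_combination -Real.sin_sq_add_cos_sq (vnorm η)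
  rw [Matrix.mem_specialOrthogonalGroup_iff, Matrix.mem_orthogonalGroup_iff]
  have hR : rodrigues η = 1 + s • hat η + c • (hat η * hat η) := by rw [rodrigues, hs, hc]
  rw [hR]
  constructor
  · ext i j
    fin_cases i <;> fin_cases j <;>
      simp [hat, Matrix.mul_apply, Fin.sum_univ_three] <;>
      grind
  · simp [hat, Matrix.det_fin_three]
    grind

/-- The rotation with rotation vector `η`. -/
def rotVec (η : Fin 3 → ℝ) : SO3 := ⟨rodrigues η, rodrigues_mem η⟩

/-- The absolute value `|θ| ∈ [0, π]` of the rotation angle of `R`. -/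
def rotAngle (R : SO3) : ℝ := Real.arccos ((Matrix.trace R.1 - 1) / 2)

/-- `R` is a rotation about the axis `ξ`. -/
def AboutAxis (ξ : Fin 3 → ℝ) (R : SO3) : Prop := ∃ θ : ℝ, R = rotVec (θ • ξ)

/-- Poses `g = (p, R)`, the elements of `SE(3)`. -/
structure SE3 where
  pos : Fin 3 → ℝ
  rot : SO3

instance : Mul SE3 := ⟨fun g h => ⟨g.rot.1 *ᵥ h.pos + g.pos, g.rot * h.rot⟩⟩

instance : Inv SE3 := ⟨fun g => ⟨-((g.rot⁻¹).1 *ᵥ g.pos), g.rot⁻¹⟩⟩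

/-- The homogeneous `4 × 4` matrix of a pose. -/
def SE3.toMat (g : SE3) : Matrix (Fin 3 ⊕ Unit) (Fin 3 ⊕ Unit) ℝ :=
  Matrix.fromBlocks g.rot.1 (Matrix.replicateCol Unit g.pos) 0 1

theorem SE3.toMat_mul (g h : SE3) : (g * h).toMat = g.toMat * h.toMat := by
  change Matrix.fromBlocks _ _ _ _ = Matrix.fromBlocks _ _ _ _ * Matrix.fromBlocks _ _ _ _
  rw [Matrix.fromBlocks_multiply]
  congr 1
  · change g.rot.1 * h.rot.1 = _
    simp
  · change Matrix.replicateCol Unit (g.rot.1 *ᵥ h.pos + g.pos) = _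
    rw [Matrix.replicateCol_add, Matrix.replicateCol_mulVec]
    simp
  · simp
  · simp

theorem SE3.toMat_inv (g : SE3) : g.toMat * (g⁻¹).toMat = 1 := by
  rw [← SE3.toMat_mul]
  change Matrix.fromBlocks (g.rot * g.rot⁻¹).1
    (Matrix.replicateCol Unit (g.rot.1 *ᵥ (-((g.rot⁻¹).1 *ᵥ g.pos)) + g.pos)) 0 1 = 1
  have h : g.rot.1 * (g.rot⁻¹).1 = 1 := by
    change (g.rot * g.rot⁻¹).1 = 1
    simp
  rw [Matrix.mulVec_neg, Matrix.mulVec_mulVec, h]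
  simp

/-- The `4 × 4` matrix in `se(3)` of a body velocity `(v, ω)`. -/
def hatSE (V : Vec6) : Matrix (Fin 3 ⊕ Unit) (Fin 3 ⊕ Unit) ℝ :=
  Matrix.fromBlocks (hat (V ∘ Sum.inr)) (Matrix.replicateCol Unit (V ∘ Sum.inl)) 0 0

/-- The adjoint matrix of a pose. -/
def adjointMat (g : SE3) : Matrix I6 I6 ℝ :=
  Matrix.fromBlocks g.rot.1 (hat g.pos * g.rot.1) 0 g.rot.1

/-- The adjoint matrix of a pure rotation. -/
def adjointRot (R : SO3) : Matrix I6 I6 ℝ := adjointMat ⟨0, R⟩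

/-- The error vector `(p, ((R - Rᵀ)/2)^∨)` of a pose. -/
def errVec (g : SE3) : Vec6 :=
  Sum.elim g.pos (vee ((1 / 2 : ℝ) • (g.rot.1 - g.rot.1ᵀ)))

/-- The pose with vector form `x = (p, η)`. -/
def poseOf (x : Vec6) : SE3 := ⟨x ∘ Sum.inl, rotVec (x ∘ Sum.inr)⟩

/-- `x` is a vector form `(p, ξθ)`, `‖ξ‖ = 1`, `|θ| ≤ π`, of the pose `g`. -/
def IsVectorForm (g : SE3) (x : Vec6) : Prop :=
  poseOf x = g ∧ vnorm (x ∘ Sum.inr) ≤ Real.pi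

/-- The vector forms of the poses in `D × SO(3)`. -/
def poseDomain (D : Set (Fin 3 → ℝ)) : Set Vec6 :=
  {x | x ∘ Sum.inl ∈ D ∧ vnorm (x ∘ Sum.inr) ≤ Real.pi}

/-! ### Gaussian process models -/

/-- Hyperparameters and input data of the Gaussian process model of one motion profile. -/
structure GPModel where
  /-- signal standard deviation -/
  σf : ℝ
  /-- lengthscale matrix -/
  Λ : Matrix I6 I6 ℝ
  /-- noise standard deviation of each output -/
  σn : I6 → ℝ
  /-- number of data points -/
  M : ℕ
  /-- training inputs -/
  input : Fin M → Vec6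
  Λ_psd : Λ.PosSemidef
  σn_pos : ∀ i, 0 < σn i

namespace GPModel

variable (G : GPModel)

/-- The squared exponential kernel. -/
def kernel (x x' : Vec6) : ℝ :=
  G.σf ^ 2 * Real.exp (-(1 / 2) * ((x - x') ⬝ᵥ (G.Λ *ᵥ (x - x'))))

/-- The Gram matrix of a finite family of inputs. -/
def gram {m : ℕ} (a : Fin m → Vec6) : Matrix (Fin m) (Fin m) ℝ :=
  Matrix.of fun j j' => G.kernel (a j) (a j')

/-- The vector of covariances between the training inputs and `x`. -/
def cov (x : Vec6) : Fin G.M → ℝ := fun j => G.kernel (G.input j) x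

/-- The regularized Gram matrix of output `i`. -/
def regGram (i : I6) : Matrix (Fin G.M) (Fin G.M) ℝ :=
  G.gram G.input + (G.σn i ^ 2) • (1 : Matrix (Fin G.M) (Fin G.M) ℝ)

/-- The posterior mean for the training outputs `Y`. -/
def mean (Y : Fin G.M → Vec6) (x : Vec6) : Vec6 := fun i =>
  G.cov x ⬝ᵥ ((G.regGram i)⁻¹ *ᵥ fun j => Y j i)

/-- The posterior variance of output `i`. -/
def var (x : Vec6) (i : I6) : ℝ :=
  G.kernel x x - G.cov x ⬝ᵥ ((G.regGram i)⁻¹ *ᵥ G.cov x)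

/-- The square root of the diagonal posterior covariance matrix. -/
def sqrtVar (x : Vec6) : Matrix I6 I6 ℝ := Matrix.diagonal fun i => Real.sqrt (G.var x i)

/-- The maximum information gain about output `i` from `M` measurements taken in `D × SO(3)`. -/
def maxInfoGain (D : Set (Fin 3 → ℝ)) (i : I6) : ℝ :=
  sSup {γ | ∃ a : Fin G.M → Vec6, (∀ j, a j ∈ poseDomain D) ∧
    γ = 1 / 2 * Real.log (1 + (G.σn i ^ 2)⁻¹ • G.gram a).det}

/-- The vector `β` for RKHS norms `B` and confidence parameter `δ`. -/
def beta (D : Set (Fin 3 → ℝ)) (B : Vec6) (δ : ℝ) : Vec6 := fun i =>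
  Real.sqrt (2 * B i ^ 2 + 300 * G.maxInfoGain D i * Real.log ((G.M + 1) / δ) ^ 3)

/-- The model error bound `‖βᵀ Σ^{1/2}(x)‖`. -/
def errBound (D : Set (Fin 3 → ℝ)) (B : Vec6) (δ : ℝ) (x : Vec6) : ℝ :=
  vnorm (G.beta D B δ ᵥ* G.sqrtVar x)

end GPModel

/-- `f` lies in the reproducing kernel Hilbert space of the scalar kernel `k` on `X`, with
norm `B`. -/
def HasRKHSNorm {X : Type} (k : X → X → ℝ) (f : X → ℝ) (B : ℝ) : Prop :=
  ∃ (H : Type) (_ : NormedAddCommGroup H) (_ : InnerProductSpace ℝ H) (_ : CompleteSpace H)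
    (_ : RKHS ℝ H X ℝ),
    (∀ x y, RKHS.kernel H x y = k x y • ContinuousLinearMap.id ℝ ℝ) ∧
    ∃ h : H, (∀ x, h x = f x) ∧ ‖h‖ = B

/-! ### The closed loop -/

/-- The matrix `N`, which depends on the rotation `R` of the control error. -/
def outputMat (R : SO3) : Matrix (I6 ⊕ I6) (I6 ⊕ I6) ℝ :=
  Matrix.fromBlocks 1 0 (-(adjointRot R⁻¹)) 1

/-- The gain matrix `diag(K_c, K_e)`. -/
def gainMat (Kc Ke : Matrix I6 I6 ℝ) : Matrix (I6 ⊕ I6) (I6 ⊕ I6) ℝ :=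
  Matrix.fromBlocks Kc 0 0 Ke

/-- The smallest eigenvalue `λ_K` of `Nᵀ K N`, over all rotations of the control error by an
angle less than `π / 2`. -/
def lamK (Kc Ke : Matrix I6 I6 ℝ) : ℝ :=
  ⨅ R : {R : SO3 // rotAngle R < Real.pi / 2},
    minEig ((outputMat R.1)ᵀ * gainMat Kc Ke * outputMat R.1)

/-- The control law `u = -K ν - Ãd μ`, as a function of the control error pose, the estimation
error pose and the mean prediction. -/
def controlLaw (Kc Ke : Matrix I6 I6 ℝ) (gce gee : SE3) (μ : Vec6) : I6 ⊕ I6 → ℝ :=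
  -(gainMat Kc Ke *ᵥ (outputMat gce.rot *ᵥ Sum.elim (errVec gce) (errVec gee)))
    - Sum.elim (adjointRot gce.rot *ᵥ (adjointRot gee.rot *ᵥ μ)) (adjointRot gee.rot *ᵥ μ)

/-- The storage function. -/
def storage (gce gee : SE3) : ℝ :=
  1 / 2 * ((vnorm gce.pos ^ 2 + Matrix.trace (1 - gce.rot.1))
    + (vnorm gee.pos ^ 2 + Matrix.trace (1 - gee.rot.1)))

/-- The function `E` whose nonpositivity defines the ellipse, with `lam = λ_K`,
`lam' = λ_K - L`. -/
def ellipseFun (lam lam' c : ℝ) (gce gee : SE3) : ℝ :=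
  Real.sqrt (vnorm (errVec gce) ^ 2 + lam' / lam * (vnorm (errVec gee) - c) ^ 2)
    - Real.sqrt (lam' / lam) * c

/-- The function `E` of one motion profile, with `lam = λ_K`, Lipschitz constant `L` and
`c(Σ(x)) = ‖βᵀ Σ^{1/2}(x)‖ / (2 (λ_K - L))`; the state is in the ellipse iff `E ≤ 0`. -/
def profileE (G : GPModel) (D : Set (Fin 3 → ℝ)) (B : Vec6) (δ lam L : ℝ) (gce gee : SE3)
    (x : Vec6) : ℝ :=
  ellipseFun lam (lam - L) (1 / (2 * (lam - L)) * G.errBound D B δ x) gce gee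

/-- The signals of the visual pursuit system. -/
structure Signals where
  /-- target pose -/
  gwo : ℝ → SE3
  /-- camera pose -/
  gwc : ℝ → SE3
  /-- observer estimate of the relative pose from camera to target -/
  gcoBar : ℝ → SE3
  /-- camera body velocity -/
  Vwc : ℝ → Vec6
  /-- vector form of the estimated target pose -/
  xBar : ℝ → Vec6

namespace Signals

variable (σ : Signals)

/-- The estimated target pose. -/
def gwoBar (t : ℝ) : SE3 := σ.gwc t * σ.gcoBar t

/-- The control error pose, for the desired relative pose `gd`. -/
def gce (gd : SE3) (t : ℝ) : SE3 := gd⁻¹ * σ.gcoBar t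

/-- The estimation error pose. -/
def gee (t : ℝ) : SE3 := (σ.gcoBar t)⁻¹ * ((σ.gwc t)⁻¹ * σ.gwo t)

/-- The stacked error vector `e = (e_c, e_e)`. -/
def err (gd : SE3) (t : ℝ) : I6 ⊕ I6 → ℝ := Sum.elim (errVec (σ.gce gd t)) (errVec (σ.gee t))

end Signals

/-- The times at which the signal `s` switches. -/
def switchTimes {Ψ : Type*} (s : ℝ → Ψ) : Set ℝ :=
  {t | 0 ≤ t ∧ ¬ ∀ᶠ τ in nhdsWithin t (Set.Ici 0), s τ = s t}

/-- A switching signal on `[0, ∞)`: finitely many switches in finite time. -/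
def IsSwitchingSignal {Ψ : Type*} (s : ℝ → Ψ) : Prop :=
  ∀ T : ℝ, (switchTimes s ∩ Set.Icc 0 T).Finite

/-- At time `t`, the curve `g` of poses has the time derivative `A`
(one-sided at `t = 0`). -/
def HasPoseDeriv (g : ℝ → SE3) (A : Matrix (Fin 3 ⊕ Unit) (Fin 3 ⊕ Unit) ℝ) (t : ℝ) : Prop :=
  ∀ i j, HasDerivWithinAt (fun τ => (g τ).toMat i j) (A i j) (Set.Ici 0) t

/-- The signals `σ` solve the closed loop on `[0, ∞)` for the motion profiles `V`, the mean
predictions `μ`, the gains `Kc`, `Ke`, the desired pose `gd` and the known switching signal `s`. -/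
structure ClosedLoop {Ψ : Type*} (V : Ψ → SE3 → Vec6) (μ : Ψ → Vec6 → Vec6)
    (Kc Ke : Matrix I6 I6 ℝ) (gd : SE3) (s : ℝ → Ψ) (σ : Signals) : Prop where
  switching : IsSwitchingSignal s
  cont_wo : ContinuousOn (fun t => (σ.gwo t).toMat) (Set.Ici 0)
  cont_wc : ContinuousOn (fun t => (σ.gwc t).toMat) (Set.Ici 0)
  cont_co : ContinuousOn (fun t => (σ.gcoBar t).toMat) (Set.Ici 0)
  vectorForm : ∀ t, 0 ≤ t → IsVectorForm (σ.gwoBar t) (σ.xBar t)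
  /-- the target moves with the active motion profile -/
  target : ∀ t, 0 ≤ t → t ∉ switchTimes s →
    HasPoseDeriv σ.gwo ((σ.gwo t).toMat * hatSE (V (s t) (σ.gwo t))) t
  /-- camera motion -/
  camera : ∀ t, 0 ≤ t → t ∉ switchTimes s →
    HasPoseDeriv σ.gwc ((σ.gwc t).toMat * hatSE (σ.Vwc t)) t
  /-- the visual motion observer, with observer input `u_e` -/
  observer : ∀ t, 0 ≤ t → t ∉ switchTimes s →
    HasPoseDeriv σ.gcoBar
      (-(hatSE (σ.Vwc t) * (σ.gcoBar t).toMat) - (σ.gcoBar t).toMat *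
        hatSE (controlLaw Kc Ke (σ.gce gd t) (σ.gee t) (μ (s t) (σ.xBar t)) ∘ Sum.inr)) t
  /-- the camera input `u_c = -Ad_{gd⁻¹} V_wc` -/
  input : ∀ t, 0 ≤ t →
    -(adjointMat gd⁻¹ *ᵥ σ.Vwc t)
      = controlLaw Kc Ke (σ.gce gd t) (σ.gee t) (μ (s t) (σ.xBar t)) ∘ Sum.inl

/-- The standing assumptions at time `t`: the target and its estimate lie in `D × SO(3)`, their
orientations are rotations about the fixed axis `ξ`, and the rotation errors are smaller than
`π / 2`. -/
structure Admissible (D : Set (Fin 3 → ℝ)) (ξ : Fin 3 → ℝ) (gd : SE3) (σ : Signals) (t : ℝ) :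
    Prop where
  pos_mem : (σ.gwo t).pos ∈ D
  posBar_mem : (σ.gwoBar t).pos ∈ D
  axis : AboutAxis ξ (σ.gwo t).rot
  axisBar : AboutAxis ξ (σ.gwoBar t).rot
  angle_ce : rotAngle (σ.gce gd t).rot < Real.pi / 2
  angle_ee : rotAngle (σ.gee t).rot < Real.pi / 2

/-- `L` is a Lipschitz constant, with respect to the estimation error vector, of the motion
profile `V` on the poses in `D × SO(3)` whose rotation axis is `ξ`. -/
def IsErrLipschitz (D : Set (Fin 3 → ℝ)) (ξ : Fin 3 → ℝ) (V : SE3 → Vec6) (L : ℝ) : Prop :=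
  ∀ g gBar : SE3, g.pos ∈ D → gBar.pos ∈ D → AboutAxis ξ g.rot → AboutAxis ξ gBar.rot →
    rotAngle (gBar⁻¹ * g).rot < Real.pi / 2 →
    vnorm (V g - V gBar) ≤ L * vnorm (errVec (gBar⁻¹ * g))

/-- A closed-loop motion on `[0, ∞)` whose active modes lie in `Φ` and which satisfies the
standing assumptions at all times. -/
def IsRun {Ψ : Type*} (D : Set (Fin 3 → ℝ)) (ξ : Fin 3 → ℝ) (V : Ψ → SE3 → Vec6)
    (μ : Ψ → Vec6 → Vec6) (Kc Ke : Matrix I6 I6 ℝ) (gd : SE3) (Φ : Set Ψ) (s : ℝ → Ψ)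
    (σ : Signals) : Prop :=
  ClosedLoop V μ Kc Ke gd s σ ∧ ∀ t, 0 ≤ t → s t ∈ Φ ∧ Admissible D ξ gd σ t

/-- The error norm is uniformly ultimately bounded along all motions `(s, σ)` in `run`. -/
def UniformlyUltimatelyBounded {Ψ : Type*} (gd : SE3) (run : (ℝ → Ψ) → Signals → Prop) : Prop :=
  ∃ b : ℝ, 0 < b ∧ ∀ a : ℝ, 0 < a → ∃ T : ℝ, 0 ≤ T ∧ ∀ s σ, run s σ →
    ∀ t₀, 0 ≤ t₀ → vnorm (σ.err gd t₀) ≤ a → ∀ t, t₀ + T ≤ t → vnorm (σ.err gd t) ≤ b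

end VisualPursuit

end

open VisualPursuit

noncomputable section

namespace VisualPursuit

/-! ### The Euclidean norm of coordinate vectors -/

section vnorm

variable {ι : Type*} [Fintype ι]

/-! The storage function `S` serves as one Lyapunov function for all modes. The skew part of a
rotation is fixed by that rotation, so the derivative of `S` pairs each error vector with the
velocities of its pose (`HasPoseDeriv.poseStorage`). The input is paired exactly with `N e`. The
gain term therefore contributes `-eᵀ Nᵀ K N e`, while in the feedforward term the two parts
containing `e_c` cancel, leaving `S' = -eᵀ Nᵀ K N e + e_e ⬝ Ad (V(g_wo) - μ)`. Inserting `V` at the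
estimated pose splits the last factor into a Lipschitz part and a model error of norm at most `Δ`,
whence `S' ≤ -λ_K ‖e_c‖² - (λ_K - L) ‖e_e‖² + Δ ‖e_e‖` (`exists_deriv_storage_le`). Completing the
square turns the right side into a negative multiple of `E (E + 2 r c)` with `r c ≥ 0`
(`ellipseFun_identity`), so `S' ≤ -λ_K E²` outside the ellipse.

For the model error, kernel ridge regression errs by at most the posterior deviation times `B + √Z`,
where `Z` is a quadratic form in the noise (`ridge_error_le`). The trace of `Z` is bounded through
the information gain, and an exponential moment gives its tail. The inputs are deterministic, so no
martingale argument is needed and the confidence is as high as `1 - δ⁶`. For item 1 any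
deterministic bound on the model error suffices.

The Lipschitz constant exists because functions in the space of a squared exponential kernel are
Lipschitz in the vector form. With a fixed axis, the only jump of the vector form, at the angles
`±π`, joins equal poses.

Switching is harmless: `S` is continuous and the exceptional times are locally finite. Strict
decrease becomes uniform by compactness (`exists_pos_le_profileE`). -/

theorem vnorm_nonneg (v : ι → ℝ) : 0 ≤ vnorm v := norm_nonneg _

theorem vnorm_sq (v : ι → ℝ) : vnorm v ^ 2 = v ⬝ᵥ v := by
  rw [vnorm, EuclideanSpace.norm_sq_eq]
  simp [dotProduct, sq]

theorem vnorm_sq_eq_sum (v : ι → ℝ) : vnorm v ^ 2 = ∑ i, v i ^ 2 := by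
  rw [vnorm_sq]; simp [dotProduct, sq]

theorem vnorm_add_le (v w : ι → ℝ) : vnorm (v + w) ≤ vnorm v + vnorm w :=
  norm_add_le (WithLp.toLp 2 v : EuclideanSpace ℝ ι) (WithLp.toLp 2 w)

theorem vnorm_zero : vnorm (0 : ι → ℝ) = 0 := norm_zero (E := EuclideanSpace ℝ ι)

theorem vnorm_smul (c : ℝ) (v : ι → ℝ) : vnorm (c • v) = |c| * vnorm v :=
  norm_smul c (WithLp.toLp 2 v : EuclideanSpace ℝ ι)

theorem vnorm_neg (v : ι → ℝ) : vnorm (-v) = vnorm v :=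
  norm_neg (WithLp.toLp 2 v : EuclideanSpace ℝ ι)

theorem vnorm_sub_le (u v w : ι → ℝ) : vnorm (u - w) ≤ vnorm (u - v) + vnorm (v - w) := by
  have := vnorm_add_le (u - v) (v - w)
  rwa [sub_add_sub_cancel] at this

theorem dotProduct_le_vnorm (v w : ι → ℝ) : v ⬝ᵥ w ≤ vnorm v * vnorm w := by
  have h := real_inner_le_norm (WithLp.toLp 2 w : EuclideanSpace ℝ ι) (WithLp.toLp 2 v)
  rw [EuclideanSpace.inner_eq_star_dotProduct, mul_comm] at h
  simpa [vnorm] using h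

theorem vnorm_mono {v w : ι → ℝ} (h : ∀ i, |v i| ≤ |w i|) : vnorm v ≤ vnorm w := by
  rw [← sq_le_sq₀ (vnorm_nonneg v) (vnorm_nonneg w), vnorm_sq_eq_sum, vnorm_sq_eq_sum]
  exact Finset.sum_le_sum fun i _ => sq_le_sq.mpr (h i)

theorem abs_le_vnorm (v : ι → ℝ) (i : ι) : |v i| ≤ vnorm v := by
  rw [← Real.sqrt_sq (vnorm_nonneg v), vnorm_sq_eq_sum, ← Real.sqrt_sq_eq_abs]
  exact Real.sqrt_le_sqrt (Finset.single_le_sum (f := fun i => v i ^ 2)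
    (fun j _ => sq_nonneg _) (Finset.mem_univ i))

theorem vnorm_le_sum (v : ι → ℝ) : vnorm v ≤ ∑ i, |v i| := by
  have h0 : 0 ≤ ∑ i, |v i| := Finset.sum_nonneg fun i _ => abs_nonneg _
  rw [← sq_le_sq₀ (vnorm_nonneg v) h0, vnorm_sq_eq_sum]
  calc ∑ i, v i ^ 2 = ∑ i, |v i| ^ 2 := by simp
    _ ≤ (∑ i, |v i|) ^ 2 := Finset.sum_sq_le_sq_sum_of_nonneg fun i _ => abs_nonneg _

theorem vnorm_sq_sumElim {κ : Type*} [Fintype κ] (v : ι → ℝ) (w : κ → ℝ) :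
    vnorm (Sum.elim v w) ^ 2 = vnorm v ^ 2 + vnorm w ^ 2 := by
  simp [vnorm_sq_eq_sum]

theorem continuous_vnorm : Continuous (vnorm : (ι → ℝ) → ℝ) := by
  have h : (vnorm : (ι → ℝ) → ℝ) = fun v => Real.sqrt (∑ i, v i ^ 2) := by
    ext v
    rw [← vnorm_sq_eq_sum, Real.sqrt_sq (vnorm_nonneg v)]
  rw [h]
  fun_prop

end vnorm

/-! ### The smallest eigenvalue -/

/-- Subtracting `minEig A` shifts the spectrum to the nonnegative half-line, so the difference is
positive semidefinite. The infimum is a genuine lower bound because the spectrum is finite. -/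
theorem minEig_mul_le {ι : Type*} [Fintype ι] [DecidableEq ι] {A : Matrix ι ι ℝ}
    (hA : A.IsSymm) (v : ι → ℝ) : minEig A * (v ⬝ᵥ v) ≤ v ⬝ᵥ (A *ᵥ v) := by
  have hH : A.IsHermitian := by
    rw [Matrix.IsHermitian, Matrix.conjTranspose_eq_transpose_of_trivial]; exact hA
  have hps : (A - minEig A • (1 : Matrix ι ι ℝ)).PosSemidef := by
    have hH' : (A - minEig A • (1 : Matrix ι ι ℝ)).IsHermitian := by
      refine hH.sub ?_
      rw [Matrix.IsHermitian, Matrix.conjTranspose_smul]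
      simp
    rw [hH'.posSemidef_iff_eigenvalues_nonneg]
    intro i
    have hmem : hH'.eigenvalues i ∈ spectrum ℝ (A - minEig A • (1 : Matrix ι ι ℝ)) := by
      rw [hH'.spectrum_real_eq_range_eigenvalues]; exact ⟨i, rfl⟩
    have hmem' : hH'.eigenvalues i + minEig A ∈ spectrum ℝ A := by
      have h2 := (spectrum.add_mem_iff (a := A - minEig A • (1 : Matrix ι ι ℝ))
        (r := hH'.eigenvalues i + minEig A) (s := minEig A)).mp
      rw [spectrum.mem_iff] at hmem ⊢
      convert hmem using 2
      rw [map_add, Algebra.algebraMap_eq_smul_one (minEig A)]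
      abel
    have hle : minEig A ≤ hH'.eigenvalues i + minEig A := by
      refine csInf_le ?_ hmem'
      rw [hH.spectrum_real_eq_range_eigenvalues]
      exact (Set.finite_range _).bddBelow
    simpa using hle
  have := hps.dotProduct_mulVec_nonneg v
  simp only [star_trivial, Matrix.sub_mulVec, Matrix.smul_mulVec, Matrix.one_mulVec,
    dotProduct_sub, dotProduct_smul, smul_eq_mul] at this
  linarith

theorem lamK_mul_le {Kc Ke : Matrix I6 I6 ℝ} (hKc : Kc.IsSymm) (hKe : Ke.IsSymm)
    (hpos : 0 < lamK Kc Ke) {R : SO3} (hR : rotAngle R < Real.pi / 2) (v : I6 ⊕ I6 → ℝ) :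
    lamK Kc Ke * (v ⬝ᵥ v) ≤
      v ⬝ᵥ (((outputMat R)ᵀ * gainMat Kc Ke * outputMat R) *ᵥ v) := by
  -- An infimum of an unbounded family is `0` by convention. Positivity of `lamK` excludes that
  -- case.
  have hbdd : BddBelow (Set.range fun R : {R : SO3 // rotAngle R < Real.pi / 2} =>
      minEig ((outputMat R.1)ᵀ * gainMat Kc Ke * outputMat R.1)) := by
    by_contra h
    exact hpos.ne' (Real.sInf_of_not_bddBelow h)
  have hsymm : ((outputMat R)ᵀ * gainMat Kc Ke * outputMat R).IsSymm := by
    have hg : (gainMat Kc Ke)ᵀ = gainMat Kc Ke := by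
      simp only [gainMat, Matrix.fromBlocks_transpose, Matrix.transpose_zero]
      rw [hKc, hKe]
    rw [Matrix.IsSymm, Matrix.transpose_mul, Matrix.transpose_mul, Matrix.transpose_transpose, hg,
      Matrix.mul_assoc]
  refine le_trans ?_ (minEig_mul_le hsymm v)
  refine mul_le_mul_of_nonneg_right (ciInf_le hbdd ⟨R, hR⟩) ?_
  rw [← vnorm_sq]; positivity

/-! ### Rotations -/

theorem SO3.mul_transpose (R : SO3) : R.1 * R.1ᵀ = 1 :=
  (Matrix.mem_orthogonalGroup_iff (Fin 3) ℝ).mp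
    (Matrix.mem_specialOrthogonalGroup_iff.mp R.2).1

theorem SO3.transpose_mul (R : SO3) : R.1ᵀ * R.1 = 1 :=
  mul_eq_one_comm.mp R.mul_transpose

theorem SO3.det_eq_one (R : SO3) : R.1.det = 1 :=
  (Matrix.mem_specialOrthogonalGroup_iff.mp R.2).2

theorem SO3.coe_inv (R : SO3) : (R⁻¹).1 = R.1ᵀ := by
  have h : R.1 * (R⁻¹).1 = 1 := by
    change (R * R⁻¹).1 = 1
    simp
  calc (R⁻¹).1 = R.1ᵀ * R.1 * (R⁻¹).1 := by rw [R.transpose_mul, one_mul]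
    _ = R.1ᵀ := by rw [Matrix.mul_assoc, h, mul_one]

theorem SO3.adjugate_eq (R : SO3) : R.1.adjugate = R.1ᵀ := by
  have h := Matrix.mul_adjugate R.1
  rw [R.det_eq_one, one_smul] at h
  calc R.1.adjugate = R.1ᵀ * R.1 * R.1.adjugate := by rw [R.transpose_mul, one_mul]
    _ = R.1ᵀ := by rw [Matrix.mul_assoc, h, mul_one]

/-- The vector of the skew-symmetric part of a rotation. -/
def skewVec (R : SO3) : Fin 3 → ℝ := vee ((1 / 2 : ℝ) • (R.1 - R.1ᵀ))

/-- The cosine of the rotation angle. -/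
def cosAngle (R : SO3) : ℝ := (Matrix.trace R.1 - 1) / 2

/-- The vector is `sin θ` times the rotation axis. Algebraically, the cofactor matrix of a rotation
is the rotation itself, and differences of opposite off-diagonal cofactors give the three
components. -/
theorem mulVec_skewVec (R : SO3) : R.1 *ᵥ skewVec R = skewVec R := by
  have h := R.adjugate_eq
  rw [Matrix.adjugate_fin_three] at h
  have h' : ∀ i j, _ := fun i j => congrFun (congrFun h i) j
  ext i
  fin_cases i
  · have a := h' 1 2; have b := h' 2 1
    simp [skewVec, vee, Matrix.mulVec, dotProduct, Fin.sum_univ_three] at a b ⊢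
    linear_combination (-(1 / 2 : ℝ)) * b + (1 / 2 : ℝ) * a
  · have a := h' 0 2; have b := h' 2 0
    simp [skewVec, vee, Matrix.mulVec, dotProduct, Fin.sum_univ_three] at a b ⊢
    linear_combination ((1 / 2 : ℝ)) * b - (1 / 2 : ℝ) * a
  · have a := h' 0 1; have b := h' 1 0
    simp [skewVec, vee, Matrix.mulVec, dotProduct, Fin.sum_univ_three] at a b ⊢
    linear_combination (-(1 / 2 : ℝ)) * b + (1 / 2 : ℝ) * a

/-- This is `sin² θ = 1 - cos² θ`, obtained from the trace of `R Rᵀ = 1` and the three diagonal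
cofactors. -/
theorem vnorm_skewVec_sq (R : SO3) : vnorm (skewVec R) ^ 2 = 1 - cosAngle R ^ 2 := by
  have h := R.adjugate_eq
  rw [Matrix.adjugate_fin_three] at h
  have h' : ∀ i j, _ := fun i j => congrFun (congrFun h i) j
  have a := h' 0 0; have b := h' 1 1; have c := h' 2 2
  have k := congrArg Matrix.trace R.mul_transpose
  rw [vnorm_sq_three]
  simp [skewVec, vee, cosAngle, Matrix.trace, Matrix.mul_apply, Fin.sum_univ_three] at a b c k ⊢
  linear_combination (1 / 4 : ℝ) * k + (1 / 2 : ℝ) * (a + b + c)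

theorem cosAngle_pos_iff {R : SO3} : rotAngle R < Real.pi / 2 ↔ 0 < cosAngle R :=
  Real.arccos_lt_pi_div_two

theorem cosAngle_nonneg_iff {R : SO3} : rotAngle R ≤ Real.pi / 2 ↔ 0 ≤ cosAngle R :=
  Real.arccos_le_pi_div_two

theorem cosAngle_le_one (R : SO3) : cosAngle R ≤ 1 := by
  have := vnorm_skewVec_sq R
  nlinarith [sq_nonneg (vnorm (skewVec R))]

/-! ### The storage function and the error vectors -/

theorem errVec_eq (g : SE3) : errVec g = Sum.elim g.pos (skewVec g.rot) := rfl

theorem vnorm_errVec_sq (g : SE3) :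
    vnorm (errVec g) ^ 2 = vnorm g.pos ^ 2 + (1 - cosAngle g.rot ^ 2) := by
  rw [errVec_eq, vnorm_sq_sumElim, vnorm_skewVec_sq]

theorem storage_eq (gce gee : SE3) :
    storage gce gee = 1 / 2 * ((vnorm gce.pos ^ 2 + 2 * (1 - cosAngle gce.rot))
      + (vnorm gee.pos ^ 2 + 2 * (1 - cosAngle gee.rot))) := by
  simp only [storage, Matrix.trace_sub, Matrix.trace_one, cosAngle, Fintype.card_fin]
  push_cast
  ring

theorem storage_nonneg (gce gee : SE3) : 0 ≤ storage gce gee := by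
  rw [storage_eq]
  have h1 := cosAngle_le_one gce.rot
  have h2 := cosAngle_le_one gee.rot
  nlinarith [sq_nonneg (vnorm gce.pos), sq_nonneg (vnorm gee.pos)]

/-- For a cosine `c`, the rotational parts differ by `2 (1 - c) - (1 - c²) = (1 - c)²`. -/
theorem err_sq_le_two_mul_storage (gce gee : SE3) :
    vnorm (errVec gce) ^ 2 + vnorm (errVec gee) ^ 2 ≤ 2 * storage gce gee := by
  rw [storage_eq, vnorm_errVec_sq, vnorm_errVec_sq]
  nlinarith [sq_nonneg (1 - cosAngle gce.rot), sq_nonneg (1 - cosAngle gee.rot)]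

/-- The angle bound `π / 2` enters here: `1 - c ≤ 1 - c²` needs `0 ≤ c ≤ 1`. Near the angle `π` the
error vector becomes small while the storage does not. -/
theorem storage_le_err_sq {gce gee : SE3} (hc : 0 ≤ cosAngle gce.rot) (he : 0 ≤ cosAngle gee.rot) :
    storage gce gee ≤ vnorm (errVec gce) ^ 2 + vnorm (errVec gee) ^ 2 := by
  rw [storage_eq, vnorm_errVec_sq, vnorm_errVec_sq]
  nlinarith [mul_nonneg hc (sub_nonneg.mpr (cosAngle_le_one gce.rot)),
    mul_nonneg he (sub_nonneg.mpr (cosAngle_le_one gee.rot)), sq_nonneg (vnorm gce.pos),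
    sq_nonneg (vnorm gee.pos)]

theorem Signals.vnorm_err_sq (σ : Signals) (gd : SE3) (t : ℝ) :
    vnorm (σ.err gd t) ^ 2 = vnorm (errVec (σ.gce gd t)) ^ 2 + vnorm (errVec (σ.gee t)) ^ 2 :=
  vnorm_sq_sumElim _ _

/-! ### Kinematics -/

theorem SE3.inv_toMat_mul (g : SE3) : (g⁻¹).toMat * g.toMat = 1 :=
  mul_eq_one_comm.mp g.toMat_inv

theorem hasPoseDeriv_const (g : SE3) (t : ℝ) : HasPoseDeriv (fun _ => g) 0 t :=
  fun _ _ => hasDerivWithinAt_const _ _ _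

theorem HasPoseDeriv.congr {g : ℝ → SE3} {A B : Matrix (Fin 3 ⊕ Unit) (Fin 3 ⊕ Unit) ℝ} {t : ℝ}
    (hg : HasPoseDeriv g B t) (h : A = B) : HasPoseDeriv g A t := h ▸ hg

theorem HasPoseDeriv.mul {g h : ℝ → SE3} {A B : Matrix (Fin 3 ⊕ Unit) (Fin 3 ⊕ Unit) ℝ} {t : ℝ}
    (hg : HasPoseDeriv g A t) (hh : HasPoseDeriv h B t) :
    HasPoseDeriv (fun τ => g τ * h τ) (A * (h t).toMat + (g t).toMat * B) t := by
  intro i j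
  simp only [SE3.toMat_mul, Matrix.mul_apply, Matrix.add_apply, ← Finset.sum_add_distrib]
  exact HasDerivWithinAt.fun_sum fun k _ => (hg i k).mul (hh k j)

theorem HasPoseDeriv.unique {g : ℝ → SE3} {A B : Matrix (Fin 3 ⊕ Unit) (Fin 3 ⊕ Unit) ℝ} {t : ℝ}
    (ht : 0 ≤ t) (hA : HasPoseDeriv g A t) (hB : HasPoseDeriv g B t) : A = B := by
  ext i j
  exact (uniqueDiffOn_Ici (0 : ℝ) t ht).eq_deriv _ (hA i j) (hB i j)

theorem SE3.toMat_mul_inv (g : SE3) : (g * g⁻¹).toMat = 1 := by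
  rw [SE3.toMat_mul, SE3.toMat_inv]

/-- Entries of the inverse are polynomials in the entries of the pose, which gives
differentiability. The product rule for `g g⁻¹ = 1` then determines the derivative. -/
theorem HasPoseDeriv.inv {g : ℝ → SE3} {A : Matrix (Fin 3 ⊕ Unit) (Fin 3 ⊕ Unit) ℝ} {t : ℝ}
    (ht : 0 ≤ t) (hg : HasPoseDeriv g A t) :
    HasPoseDeriv (fun τ => (g τ)⁻¹) (-((g t)⁻¹.toMat * A * (g t)⁻¹.toMat)) t := by
  obtain ⟨B, hB⟩ : ∃ B, HasPoseDeriv (fun τ => (g τ)⁻¹) B t := by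
    refine ⟨Matrix.of fun i j => derivWithin (fun τ => ((g τ)⁻¹).toMat i j) (Set.Ici 0) t,
      fun i j => DifferentiableWithinAt.hasDerivWithinAt ?_⟩
    have hrot : ∀ i j, DifferentiableWithinAt ℝ (fun τ => (g τ).rot.1 i j) (Set.Ici 0) t :=
      fun i j => (hg (Sum.inl i) (Sum.inl j)).differentiableWithinAt
    have hpos : ∀ i, DifferentiableWithinAt ℝ (fun τ => (g τ).pos i) (Set.Ici 0) t :=
      fun i => (hg (Sum.inl i) (Sum.inr ())).differentiableWithinAt
    rcases i with i | i <;> rcases j with j | j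
    · have : (fun τ => ((g τ)⁻¹).toMat (Sum.inl i) (Sum.inl j)) = fun τ => (g τ).rot.1 j i := by
        ext τ
        change ((g τ).rot⁻¹).1 i j = _
        rw [SO3.coe_inv]; rfl
      rw [this]; exact hrot j i
    · have : (fun τ => ((g τ)⁻¹).toMat (Sum.inl i) (Sum.inr j)) =
          fun τ => -∑ k, (g τ).rot.1 k i * (g τ).pos k := by
        ext τ
        change (-(((g τ).rot⁻¹).1 *ᵥ (g τ).pos)) i = _
        rw [SO3.coe_inv]; rfl
      rw [this]
      exact (DifferentiableWithinAt.fun_sum fun k _ => (hrot k i).mul (hpos k)).neg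
    · exact differentiableWithinAt_const _
    · exact differentiableWithinAt_const _
  have h1 : HasPoseDeriv (fun τ => g τ * (g τ)⁻¹) 0 t := by
    intro i j
    simp only [SE3.toMat_mul_inv]
    exact hasDerivWithinAt_const _ _ _
  have h2 := (hg.mul hB).unique ht h1
  have h3 : B = -((g t)⁻¹.toMat * A * (g t)⁻¹.toMat) := by
    calc B = (g t)⁻¹.toMat * ((g t).toMat * B) := by
          rw [← Matrix.mul_assoc, SE3.inv_toMat_mul, Matrix.one_mul]
      _ = (g t)⁻¹.toMat * -(A * (g t)⁻¹.toMat) := by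
          rw [eq_neg_of_add_eq_zero_right h2]
      _ = _ := by rw [Matrix.mul_neg, Matrix.mul_assoc]
  rwa [← h3]

theorem hat_neg (a : Fin 3 → ℝ) : hat (-a) = -hat a := by
  ext i j; fin_cases i <;> fin_cases j <;> simp [hat]

theorem hatSE_neg (V : Vec6) : hatSE (-V) = -hatSE V := by
  have h1 : (-V) ∘ Sum.inr = -(V ∘ Sum.inr) := rfl
  have h2 : (-V) ∘ Sum.inl = -(V ∘ Sum.inl) := rfl
  rw [hatSE, hatSE, h1, h2, hat_neg, Matrix.fromBlocks_neg]
  simp only [neg_zero]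
  rfl

/-- As bilinear forms, both sides are triple products: `Ma ⬝ (Mw × Mb) = det M (a ⬝ (w × b))`. -/
theorem transpose_mul_hat_mul (M : Matrix (Fin 3) (Fin 3) ℝ) (w : Fin 3 → ℝ) :
    Mᵀ * hat (M *ᵥ w) * M = M.det • hat w := by
  ext i j
  fin_cases i <;> fin_cases j <;>
    simp [hat, Matrix.mul_apply, Matrix.mulVec, dotProduct, Fin.sum_univ_three,
      Matrix.det_fin_three] <;> ring

theorem hat_mulVec_mul (R : SO3) (w : Fin 3 → ℝ) : hat (R.1 *ᵥ w) * R.1 = R.1 * hat w := by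
  have h := transpose_mul_hat_mul R.1 w
  rw [R.det_eq_one, one_smul] at h
  rw [← h, ← Matrix.mul_assoc, ← Matrix.mul_assoc, R.mul_transpose, Matrix.one_mul]

theorem hatSE_adjointMat_mul (g : SE3) (V : Vec6) :
    hatSE (adjointMat g *ᵥ V) * g.toMat = g.toMat * hatSE V := by
  have hr : (adjointMat g *ᵥ V) ∘ Sum.inr = g.rot.1 *ᵥ (V ∘ Sum.inr) := by
    rw [adjointMat, Matrix.fromBlocks_mulVec]
    ext i; simp
  have hl : (adjointMat g *ᵥ V) ∘ Sum.inl =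
      g.rot.1 *ᵥ (V ∘ Sum.inl) + hat g.pos *ᵥ (g.rot.1 *ᵥ (V ∘ Sum.inr)) := by
    rw [adjointMat, Matrix.fromBlocks_mulVec]
    ext i; simp [Matrix.mulVec_mulVec]
  have hcross : ∀ a b : Fin 3 → ℝ, hat a *ᵥ b + hat b *ᵥ a = 0 := by
    intro a b
    rw [hat_mulVec, hat_mulVec, ← neg_cross a b]; simp
  rw [hatSE, hatSE, hr, hl, SE3.toMat, Matrix.fromBlocks_multiply, Matrix.fromBlocks_multiply]
  congr 1
  · simp [hat_mulVec_mul]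
  · rw [← Matrix.replicateCol_mulVec, ← Matrix.replicateCol_mulVec, Matrix.mul_one,
      Matrix.mul_zero, add_zero, ← Matrix.replicateCol_add, add_left_comm, hcross, add_zero]
  · simp
  · simp

/-- Conjugation by `gd⁻¹` turns the camera velocity into the left velocity `u_c`, while `-u_e` acts
from the right. -/
theorem hasPoseDeriv_gce {Ψ : Type*} {V : Ψ → SE3 → Vec6} {μ : Ψ → Vec6 → Vec6}
    {Kc Ke : Matrix I6 I6 ℝ} {gd : SE3} {s : ℝ → Ψ} {σ : Signals}
    (h : ClosedLoop V μ Kc Ke gd s σ) {t : ℝ} (ht : 0 ≤ t) (hs : t ∉ switchTimes s) {uc ue : Vec6}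
    (huc : uc = controlLaw Kc Ke (σ.gce gd t) (σ.gee t) (μ (s t) (σ.xBar t)) ∘ Sum.inl)
    (hue : ue = controlLaw Kc Ke (σ.gce gd t) (σ.gee t) (μ (s t) (σ.xBar t)) ∘ Sum.inr) :
    HasPoseDeriv (σ.gce gd)
      (hatSE uc * (σ.gce gd t).toMat + (σ.gce gd t).toMat * hatSE (-ue)) t := by
  have h1 := (hasPoseDeriv_const gd⁻¹ t).mul (h.observer t ht hs)
  rw [← hue] at h1
  refine h1.congr ?_
  rw [huc, ← h.input t ht, Matrix.zero_mul, zero_add, hatSE_neg, hatSE_neg]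
  simp only [Signals.gce, SE3.toMat_mul]
  rw [Matrix.neg_mul, ← Matrix.mul_assoc (hatSE _), hatSE_adjointMat_mul]
  simp only [Matrix.mul_add, Matrix.mul_neg, Matrix.mul_assoc, sub_eq_add_neg]

/-- The camera velocity enters through both inverse factors with opposite signs and drops out. -/
theorem hasPoseDeriv_gee {Ψ : Type*} {V : Ψ → SE3 → Vec6} {μ : Ψ → Vec6 → Vec6}
    {Kc Ke : Matrix I6 I6 ℝ} {gd : SE3} {s : ℝ → Ψ} {σ : Signals}
    (h : ClosedLoop V μ Kc Ke gd s σ) {t : ℝ} (ht : 0 ≤ t) (hs : t ∉ switchTimes s) {ue : Vec6}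
    (hue : ue = controlLaw Kc Ke (σ.gce gd t) (σ.gee t) (μ (s t) (σ.xBar t)) ∘ Sum.inr) :
    HasPoseDeriv σ.gee
      (hatSE ue * (σ.gee t).toMat + (σ.gee t).toMat * hatSE (V (s t) (σ.gwo t))) t := by
  have h1 := ((h.observer t ht hs).inv ht).mul
    (((h.camera t ht hs).inv ht).mul (h.target t ht hs))
  rw [← hue] at h1
  refine h1.congr ?_
  simp only [Signals.gee, SE3.toMat_mul]
  generalize hatSE ue = U
  generalize hatSE (σ.Vwc t) = W
  generalize hatSE (V (s t) (σ.gwo t)) = X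
  have hc := (σ.gcoBar t).inv_toMat_mul
  have hc' := (σ.gcoBar t).toMat_inv
  have hw := (σ.gwc t).inv_toMat_mul
  generalize (σ.gcoBar t).toMat = C at *
  generalize ((σ.gcoBar t)⁻¹).toMat = C' at *
  generalize (σ.gwc t).toMat = A at *
  generalize ((σ.gwc t)⁻¹).toMat = A' at *
  generalize (σ.gwo t).toMat = O at *
  have e1 : C' * (-(W * C) - C * U) * C' = -(C' * W) - U * C' := by
    calc C' * (-(W * C) - C * U) * C' = -(C' * W * (C * C')) - (C' * C) * U * C' := by
          noncomm_ring
      _ = _ := by rw [hc, hc']; noncomm_ring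
  have e2 : A' * (A * W) * A' = W * A' := by
    rw [← Matrix.mul_assoc, hw, Matrix.one_mul]
  rw [e1, e2]
  noncomm_ring

theorem adjointRot_mulVec (R : SO3) (W : Vec6) :
    adjointRot R *ᵥ W = Sum.elim (R.1 *ᵥ (W ∘ Sum.inl)) (R.1 *ᵥ (W ∘ Sum.inr)) := by
  have : hat 0 = 0 := by ext i j; fin_cases i <;> fin_cases j <;> simp [hat]
  rw [adjointRot, adjointMat, Matrix.fromBlocks_mulVec]
  simp [this]

theorem adjointRot_inv (R : SO3) : adjointRot R⁻¹ = (adjointRot R)ᵀ := by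
  have : hat 0 = 0 := by ext i j; fin_cases i <;> fin_cases j <;> simp [hat]
  simp [adjointRot, adjointMat, Matrix.fromBlocks_transpose, this, SO3.coe_inv]

theorem vnorm_SO3_mulVec (R : SO3) (v : Fin 3 → ℝ) : vnorm (R.1 *ᵥ v) = vnorm v := by
  rw [← sq_eq_sq₀ (vnorm_nonneg _) (vnorm_nonneg _), vnorm_sq, vnorm_sq, Matrix.dotProduct_mulVec,
    ← Matrix.mulVec_transpose, Matrix.mulVec_mulVec, R.transpose_mul, Matrix.one_mulVec]

theorem vnorm_adjointRot_mulVec (R : SO3) (W : Vec6) : vnorm (adjointRot R *ᵥ W) = vnorm W := by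
  rw [← sq_eq_sq₀ (vnorm_nonneg _) (vnorm_nonneg _), adjointRot_mulVec, vnorm_sq_sumElim,
    vnorm_SO3_mulVec, vnorm_SO3_mulVec, ← vnorm_sq_sumElim, Sum.elim_comp_inl_inr]

theorem skewVec_dotProduct (R : SO3) (w : Fin 3 → ℝ) :
    skewVec R ⬝ᵥ w = -(1 / 2) * Matrix.trace (R.1 * hat w) := by
  simp [skewVec, vee, hat, Matrix.trace, Matrix.mul_apply, dotProduct, Fin.sum_univ_three]
  ring

theorem skewVec_dotProduct_mulVec (R : SO3) (w : Fin 3 → ℝ) :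
    skewVec R ⬝ᵥ (R.1 *ᵥ w) = skewVec R ⬝ᵥ w := by
  conv_lhs => rw [← mulVec_skewVec R]
  rw [Matrix.dotProduct_mulVec, ← Matrix.mulVec_transpose, Matrix.mulVec_mulVec, R.transpose_mul,
    Matrix.one_mulVec]

/-- The storage function of one error pose. -/
def poseStorage (g : SE3) : ℝ := 1 / 2 * (vnorm g.pos ^ 2 + Matrix.trace (1 - g.rot.1))

theorem storage_eq_add (gce gee : SE3) : storage gce gee = poseStorage gce + poseStorage gee := by
  rw [storage, poseStorage, poseStorage]; ring

/-- Passivity of the rigid body motion. -/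
theorem HasPoseDeriv.poseStorage {g : ℝ → SE3} {U W : Vec6} {t : ℝ}
    (hg : HasPoseDeriv g (hatSE U * (g t).toMat + (g t).toMat * hatSE W) t) :
    HasDerivWithinAt (fun τ => poseStorage (g τ))
      (errVec (g t) ⬝ᵥ (U + adjointRot (g t).rot *ᵥ W)) (Set.Ici 0) t := by
  obtain ⟨R', hR'⟩ : ∃ R', R' = hat (U ∘ Sum.inr) * (g t).rot.1
    + (g t).rot.1 * hat (W ∘ Sum.inr) := ⟨_, rfl⟩
  obtain ⟨p', hp'⟩ : ∃ p', p' = hat (U ∘ Sum.inr) *ᵥ (g t).pos + U ∘ Sum.inl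
    + (g t).rot.1 *ᵥ (W ∘ Sum.inl) := ⟨_, rfl⟩
  have hA : hatSE U * (g t).toMat + (g t).toMat * hatSE W
      = Matrix.fromBlocks R' (Matrix.replicateCol Unit p') 0 0 := by
    rw [hatSE, hatSE, SE3.toMat, Matrix.fromBlocks_multiply, Matrix.fromBlocks_multiply,
      Matrix.fromBlocks_add, hR', hp', Matrix.replicateCol_add, Matrix.replicateCol_add,
      Matrix.replicateCol_mulVec, Matrix.replicateCol_mulVec]
    simp
  rw [hA] at hg
  have hrot : ∀ i j, HasDerivWithinAt (fun τ => (g τ).rot.1 i j) (R' i j) (Set.Ici 0) t :=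
    fun i j => hg (Sum.inl i) (Sum.inl j)
  have hpos : ∀ i, HasDerivWithinAt (fun τ => (g τ).pos i) (p' i) (Set.Ici 0) t :=
    fun i => hg (Sum.inl i) (Sum.inr ())
  have h1 : HasDerivWithinAt (fun τ => VisualPursuit.poseStorage (g τ))
      (1 / 2 * (∑ i, 2 * ((g t).pos i * p' i) - Matrix.trace R')) (Set.Ici 0) t := by
    have e : (fun τ => VisualPursuit.poseStorage (g τ)) = fun τ =>
        1 / 2 * (∑ i, (g τ).pos i ^ 2 + (3 - ∑ i, (g τ).rot.1 i i)) := by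
      ext τ
      rw [VisualPursuit.poseStorage, vnorm_sq_eq_sum, Matrix.trace_sub, Matrix.trace_one]
      simp [Matrix.trace]
    rw [e]
    refine HasDerivWithinAt.const_mul _ ?_
    rw [sub_eq_add_neg]
    refine HasDerivWithinAt.add (HasDerivWithinAt.fun_sum fun i _ => ?_) ?_
    · refine ((hpos i).fun_pow 2).congr_deriv ?_
      norm_num [mul_assoc]
    · exact HasDerivWithinAt.const_sub _ (HasDerivWithinAt.fun_sum fun i _ => hrot i i)
  convert h1 using 1
  have e2 : (∑ i, 2 * ((g t).pos i * p' i)) = 2 * ((g t).pos ⬝ᵥ p') := by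
    rw [dotProduct, Finset.mul_sum]
  have hself : (g t).pos ⬝ᵥ (hat (U ∘ Sum.inr) *ᵥ (g t).pos) = 0 := by
    rw [hat_mulVec]; exact dot_cross_self _ _
  have hU : errVec (g t) ⬝ᵥ U = (g t).pos ⬝ᵥ (U ∘ Sum.inl)
      + skewVec (g t).rot ⬝ᵥ (U ∘ Sum.inr) := by
    rw [errVec_eq, ← Sum.elim_comp_inl_inr U, sumElim_dotProduct_sumElim]
    simp
  -- The derivative of `-tr R / 2` is the pairing of the skew vector with both angular velocities.
  -- The right velocity `W` may be replaced by `R W` because `R` fixes the skew vector.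
  rw [e2, dotProduct_add, hU, adjointRot_mulVec, errVec_eq, sumElim_dotProduct_sumElim,
    skewVec_dotProduct_mulVec, hp', hR', dotProduct_add, dotProduct_add, hself, Matrix.trace_add,
    skewVec_dotProduct, skewVec_dotProduct, Matrix.trace_mul_comm (hat _)]
  ring

/-- The time derivative of the storage function along the closed loop. -/
theorem hasDerivWithinAt_storage {Ψ : Type*} {V : Ψ → SE3 → Vec6} {μ : Ψ → Vec6 → Vec6}
    {Kc Ke : Matrix I6 I6 ℝ} {gd : SE3} {s : ℝ → Ψ} {σ : Signals}
    (h : ClosedLoop V μ Kc Ke gd s σ) {t : ℝ} (ht : 0 ≤ t) (hs : t ∉ switchTimes s) :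
    HasDerivWithinAt (fun τ => storage (σ.gce gd τ) (σ.gee τ))
      (-(σ.err gd t ⬝ᵥ (((outputMat (σ.gce gd t).rot)ᵀ * gainMat Kc Ke
          * outputMat (σ.gce gd t).rot) *ᵥ σ.err gd t))
        + errVec (σ.gee t) ⬝ᵥ (adjointRot (σ.gee t).rot *ᵥ
          (V (s t) (σ.gwo t) - μ (s t) (σ.xBar t)))) (Set.Ici 0) t := by
  simp only [storage_eq_add]
  have h1 := (hasPoseDeriv_gce h ht hs rfl rfl).poseStorage.fun_add
    (hasPoseDeriv_gee h ht hs rfl).poseStorage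
  refine h1.congr_deriv (Eq.symm ?_)
  rw [Signals.err, Matrix.mul_assoc, ← Matrix.mulVec_mulVec, ← Matrix.mulVec_mulVec,
    Matrix.dotProduct_mulVec (Sum.elim _ _) (outputMat _)ᵀ, Matrix.vecMul_transpose]
  generalize σ.gce gd t = gc
  generalize σ.gee t = ge
  generalize V (s t) (σ.gwo t) = v
  generalize μ (s t) (σ.xBar t) = m
  -- The second block, `e_e - Adᵀ e_c`, is what `u_e` is paired with, since `u_e` drives the
  -- estimation error and, with opposite sign and after `Ad`, the control error. This is why the
  -- feedback is taken from `N e`.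
  have hN : outputMat gc.rot *ᵥ Sum.elim (errVec gc) (errVec ge)
      = Sum.elim (errVec gc) (errVec ge - (adjointRot gc.rot)ᵀ *ᵥ errVec gc) := by
    rw [outputMat, Matrix.fromBlocks_mulVec, adjointRot_inv]
    simp only [Sum.elim_comp_inl, Sum.elim_comp_inr, Matrix.one_mulVec, Matrix.zero_mulVec,
      add_zero, Matrix.neg_mulVec]
    congr 1
    abel
  rw [controlLaw, hN]
  generalize gainMat Kc Ke *ᵥ _ = k
  generalize adjointRot gc.rot = A
  generalize adjointRot ge.rot = B
  rw [← Sum.elim_comp_inl_inr k, sumElim_dotProduct_sumElim]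
  have e1 : (-Sum.elim (k ∘ Sum.inl) (k ∘ Sum.inr) - Sum.elim (A *ᵥ B *ᵥ m) (B *ᵥ m)) ∘ Sum.inl
      = -(k ∘ Sum.inl) - A *ᵥ B *ᵥ m := rfl
  have e2 : (-Sum.elim (k ∘ Sum.inl) (k ∘ Sum.inr) - Sum.elim (A *ᵥ B *ᵥ m) (B *ᵥ m)) ∘ Sum.inr
      = -(k ∘ Sum.inr) - B *ᵥ m := rfl
  have hT : ∀ z, (Aᵀ *ᵥ errVec gc) ⬝ᵥ z = errVec gc ⬝ᵥ (A *ᵥ z) := by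
    intro z
    rw [Matrix.mulVec_transpose, Matrix.dotProduct_mulVec]
  rw [e1, e2]
  simp only [Matrix.mulVec_sub, Matrix.mulVec_neg, dotProduct_add, dotProduct_sub, dotProduct_neg,
    sub_dotProduct, hT]
  ring

/-! ### Kernel ridge regression -/

section ridge

variable {m : ℕ}

/-- Diagonalization of a real positive semidefinite matrix. -/
theorem exists_diagonalization {K : Matrix (Fin m) (Fin m) ℝ} (hK : K.PosSemidef) :
    ∃ (U : Matrix (Fin m) (Fin m) ℝ) (l : Fin m → ℝ), Uᵀ * U = 1 ∧ (∀ k, 0 ≤ l k) ∧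
      K = U * Matrix.diagonal l * Uᵀ := by
  refine ⟨hK.1.eigenvectorUnitary, hK.1.eigenvalues, ?_, hK.eigenvalues_nonneg, ?_⟩
  · have := Unitary.coe_star_mul_self hK.1.eigenvectorUnitary
    rwa [Matrix.star_eq_conjTranspose, Matrix.conjTranspose_eq_transpose_of_trivial] at this
  · have := hK.1.spectral_theorem
    rw [Unitary.conjStarAlgAut_apply, Matrix.star_eq_conjTranspose,
      Matrix.conjTranspose_eq_transpose_of_trivial] at this
    exact this

theorem det_one_add_smul_diagonalization {U : Matrix (Fin m) (Fin m) ℝ} {l : Fin m → ℝ} (r : ℝ)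
    (hU : Uᵀ * U = 1) :
    (1 + r • (U * Matrix.diagonal l * Uᵀ)).det = ∏ k, (1 + r * l k) := by
  have hU' : U * Uᵀ = 1 := mul_eq_one_comm.mp hU
  have : 1 + r • (U * Matrix.diagonal l * Uᵀ) = U * Matrix.diagonal (fun k => 1 + r * l k) * Uᵀ := by
    have hd : Matrix.diagonal (fun k => 1 + r * l k) = 1 + r • Matrix.diagonal l := by
      rw [← Matrix.diagonal_one, ← Matrix.diagonal_smul, Matrix.diagonal_add]
      rfl
    rw [hd, Matrix.mul_add, Matrix.add_mul, Matrix.mul_one, hU']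
    simp
  rw [this, Matrix.det_mul, Matrix.det_mul, Matrix.det_diagonal, mul_comm, ← mul_assoc,
    ← Matrix.det_mul, hU, Matrix.det_one, one_mul]

theorem dotProduct_mul_inv_mulVec {U : Matrix (Fin m) (Fin m) ℝ} {l : Fin m → ℝ} {r : ℝ}
    (hr : 0 < r) (hU : Uᵀ * U = 1) (hl : ∀ k, 0 ≤ l k) (ε : Fin m → ℝ) :
    ε ⬝ᵥ ((U * Matrix.diagonal l * Uᵀ)
        *ᵥ ((U * Matrix.diagonal l * Uᵀ + r • (1 : Matrix (Fin m) (Fin m) ℝ))⁻¹ *ᵥ ε))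
      = ∑ k, l k / (l k + r) * (∑ j, U j k * ε j) ^ 2 := by
  have hU' : U * Uᵀ = 1 := mul_eq_one_comm.mp hU
  have hne : ∀ k, l k + r ≠ 0 := fun k => by have := hl k; positivity
  have hG : U * Matrix.diagonal l * Uᵀ + r • (1 : Matrix (Fin m) (Fin m) ℝ)
      = U * Matrix.diagonal (fun k => l k + r) * Uᵀ := by
    have hd : Matrix.diagonal (fun k => l k + r)
        = Matrix.diagonal l + r • (1 : Matrix (Fin m) (Fin m) ℝ) := by
      rw [← Matrix.diagonal_one, ← Matrix.diagonal_smul, Matrix.diagonal_add]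
      simp
    rw [hd, Matrix.mul_add, Matrix.add_mul, Matrix.mul_smul, Matrix.smul_mul, Matrix.mul_one, hU']
  have hinv : (U * Matrix.diagonal l * Uᵀ + r • (1 : Matrix (Fin m) (Fin m) ℝ))⁻¹
      = U * Matrix.diagonal (fun k => (l k + r)⁻¹) * Uᵀ := by
    apply Matrix.inv_eq_right_inv
    rw [hG]
    calc U * Matrix.diagonal (fun k => l k + r) * Uᵀ
          * (U * Matrix.diagonal (fun k => (l k + r)⁻¹) * Uᵀ)
        = U * Matrix.diagonal (fun k => l k + r) * (Uᵀ * U)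
          * Matrix.diagonal (fun k => (l k + r)⁻¹) * Uᵀ := by noncomm_ring
      _ = 1 := by
        rw [hU, Matrix.mul_one, Matrix.mul_assoc U, Matrix.diagonal_mul_diagonal]
        simp [hne, hU']
  rw [hinv, Matrix.mulVec_mulVec]
  have hmul : U * Matrix.diagonal l * Uᵀ * (U * Matrix.diagonal (fun k => (l k + r)⁻¹) * Uᵀ)
      = U * Matrix.diagonal (fun k => l k / (l k + r)) * Uᵀ := by
    calc U * Matrix.diagonal l * Uᵀ * (U * Matrix.diagonal (fun k => (l k + r)⁻¹) * Uᵀ)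
        = U * Matrix.diagonal l * (Uᵀ * U)
          * Matrix.diagonal (fun k => (l k + r)⁻¹) * Uᵀ := by noncomm_ring
      _ = _ := by
        rw [hU, Matrix.mul_one, Matrix.mul_assoc U, Matrix.diagonal_mul_diagonal]
        rfl
  rw [hmul, ← Matrix.mulVec_mulVec, ← Matrix.mulVec_mulVec, Matrix.dotProduct_mulVec,
    ← Matrix.mulVec_transpose]
  simp only [dotProduct, Matrix.mulVec_diagonal]
  refine Finset.sum_congr rfl fun k _ => ?_
  simp only [Matrix.mulVec, dotProduct, Matrix.transpose_apply]
  ring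

variable {H : Type*} [NormedAddCommGroup H] [InnerProductSpace ℝ H]

theorem inner_sum_smul_eq_dotProduct (φ : Fin m → H) (a b : Fin m → ℝ) :
    inner ℝ (∑ j, a j • φ j) (∑ j, b j • φ j) = a ⬝ᵥ (Matrix.gram ℝ φ *ᵥ b) := by
  simp only [sum_inner, inner_sum, inner_smul_left, inner_smul_right, dotProduct, Matrix.mulVec,
    Matrix.gram_apply, Finset.mul_sum]
  rw [Finset.sum_comm]
  refine Finset.sum_congr rfl fun i _ => Finset.sum_congr rfl fun j _ => ?_
  simp only [conj_trivial]
  ring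

/-- The prediction error of kernel ridge regression is at most the posterior standard deviation
times the sum of the norm of the target function and a quadratic form of the noise. -/
theorem ridge_error_le (φ : Fin m → H) (φx h : H) (ε : Fin m → ℝ) {s : ℝ} (hs : 0 < s)
    {K W : Matrix (Fin m) (Fin m) ℝ} (hK : K = Matrix.gram ℝ φ)
    (hW : W = (K + (s ^ 2) • (1 : Matrix (Fin m) (Fin m) ℝ))⁻¹)
    {k : Fin m → ℝ} (hk : k = fun j => inner ℝ (φ j) φx) :
    |inner ℝ h φx - k ⬝ᵥ (W *ᵥ fun j => inner ℝ h (φ j) + ε j)|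
      ≤ Real.sqrt (inner ℝ φx φx - k ⬝ᵥ (W *ᵥ k))
        * (‖h‖ + Real.sqrt ((s ^ 2)⁻¹ * ε ⬝ᵥ (K *ᵥ (W *ᵥ ε)))) ∧
    0 ≤ (s ^ 2)⁻¹ * ε ⬝ᵥ (K *ᵥ (W *ᵥ ε)) := by
  obtain ⟨G, hG⟩ : ∃ G, G = K + (s ^ 2) • (1 : Matrix (Fin m) (Fin m) ℝ) := ⟨_, rfl⟩
  rw [← hG] at hW
  have hKps : K.PosSemidef := hK ▸ Matrix.posSemidef_gram ℝ φ
  have hKs : Kᵀ = K := by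
    have := hKps.1
    rwa [Matrix.IsHermitian, Matrix.conjTranspose_eq_transpose_of_trivial] at this
  have hGpd : G.PosDef := by
    rw [hG]
    exact Matrix.PosDef.posSemidef_add hKps (Matrix.PosDef.one.smul (by positivity))
  have hdet : IsUnit G.det := (Matrix.isUnit_iff_isUnit_det _).mp hGpd.isUnit
  have hGW : G * W = 1 := by rw [hW]; exact Matrix.mul_nonsing_inv _ hdet
  have hGs : Gᵀ = G := by rw [hG, Matrix.transpose_add, Matrix.transpose_smul, hKs]; simp
  have hWs : Wᵀ = W := by rw [hW, Matrix.transpose_nonsing_inv, hGs]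
  have hsymW : ∀ u v : Fin m → ℝ, u ⬝ᵥ (W *ᵥ v) = (W *ᵥ u) ⬝ᵥ v := by
    intro u v
    rw [Matrix.dotProduct_mulVec, ← Matrix.mulVec_transpose, hWs]
  have hsymK : ∀ u v : Fin m → ℝ, u ⬝ᵥ (K *ᵥ v) = (K *ᵥ u) ⬝ᵥ v := by
    intro u v
    rw [Matrix.dotProduct_mulVec, ← Matrix.mulVec_transpose, hKs]
  have hsolve : ∀ v : Fin m → ℝ, K *ᵥ (W *ᵥ v) + s ^ 2 • (W *ᵥ v) = v := by
    intro v
    have : G *ᵥ (W *ᵥ v) = v := by rw [Matrix.mulVec_mulVec, hGW, Matrix.one_mulVec]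
    rw [hG, Matrix.add_mulVec, Matrix.smul_mulVec, Matrix.one_mulVec] at this
    exact this
  -- With the ridge weights `a = W k`, the prediction error is `⟨h, φx - Φa⟩ - a ⬝ ε`. The vector `b
  -- = W ε` makes the noise part accessible to an inner product estimate.
  obtain ⟨a, ha⟩ : ∃ a, a = W *ᵥ k := ⟨_, rfl⟩
  obtain ⟨b, hb⟩ : ∃ b, b = W *ᵥ ε := ⟨_, rfl⟩
  have hak : K *ᵥ a + s ^ 2 • a = k := ha ▸ hsolve k
  have hbε : K *ᵥ b + s ^ 2 • b = ε := hb ▸ hsolve ε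
  obtain ⟨Φa, hΦa⟩ : ∃ Φa, Φa = ∑ j, a j • φ j := ⟨_, rfl⟩
  obtain ⟨Φb, hΦb⟩ : ∃ Φb, Φb = ∑ j, b j • φ j := ⟨_, rfl⟩
  have hin : ∀ c : Fin m → ℝ, inner ℝ φx (∑ j, c j • φ j) = c ⬝ᵥ k := by
    intro c
    simp only [inner_sum, inner_smul_right, dotProduct, hk]
    refine Finset.sum_congr rfl fun j _ => ?_
    rw [real_inner_comm]
  have hinh : inner ℝ h Φa = a ⬝ᵥ fun j => inner ℝ h (φ j) := by
    simp only [hΦa, inner_sum, inner_smul_right, dotProduct]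
  have haa : inner ℝ Φa Φa = a ⬝ᵥ (K *ᵥ a) := by
    rw [hΦa, inner_sum_smul_eq_dotProduct, hK]
  have hab : inner ℝ Φa Φb = a ⬝ᵥ (K *ᵥ b) := by
    rw [hΦa, hΦb, inner_sum_smul_eq_dotProduct, hK]
  have hbb : inner ℝ Φb Φb = b ⬝ᵥ (K *ᵥ b) := by
    rw [hΦb, inner_sum_smul_eq_dotProduct, hK]
  have hxa : inner ℝ φx Φa = a ⬝ᵥ k := by rw [hΦa, hin]
  have hxb : inner ℝ φx Φb = b ⬝ᵥ k := by rw [hΦb, hin]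
  obtain ⟨v, hv⟩ : ∃ v, v = inner ℝ φx φx - k ⬝ᵥ (W *ᵥ k) := ⟨_, rfl⟩
  obtain ⟨Z, hZ⟩ : ∃ Z, Z = (s ^ 2)⁻¹ * ε ⬝ᵥ (K *ᵥ (W *ᵥ ε)) := ⟨_, rfl⟩
  have eak := congrArg (fun w => a ⬝ᵥ w) hak
  have ebk := congrArg (fun w => b ⬝ᵥ w) hak
  have eaε := congrArg (fun w => a ⬝ᵥ w) hbε
  simp only [dotProduct_add, dotProduct_smul, smul_eq_mul] at eak ebk eaε
  have hvar : ‖φx - Φa‖ ^ 2 + s ^ 2 * (a ⬝ᵥ a) = v := by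
    rw [← real_inner_self_eq_norm_sq, inner_sub_left, inner_sub_right, inner_sub_right,
      real_inner_comm φx Φa, hxa, haa, hv, ← ha, dotProduct_comm k a]
    linarith
  have hZ' : ‖Φb‖ ^ 2 + (s ^ 2)⁻¹ * ((K *ᵥ b) ⬝ᵥ (K *ᵥ b)) = Z := by
    rw [← real_inner_self_eq_norm_sq, hbb, hZ, ← hb]
    have : ε ⬝ᵥ (K *ᵥ b) = (K *ᵥ b) ⬝ᵥ (K *ᵥ b) + s ^ 2 * (b ⬝ᵥ (K *ᵥ b)) := by
      conv_lhs => rw [← hbε]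
      rw [add_dotProduct, smul_dotProduct, smul_eq_mul]
    rw [this]; field_simp; ring
  have haε : a ⬝ᵥ ε = inner ℝ (φx - Φa) Φb + a ⬝ᵥ (K *ᵥ b) := by
    rw [inner_sub_left, hxb, hab, ← eaε, dotProduct_comm a b]
    have : b ⬝ᵥ (K *ᵥ a) = a ⬝ᵥ (K *ᵥ b) := by rw [hsymK b a, dotProduct_comm]
    linarith
  have hZ0 : 0 ≤ Z := by
    rw [← hZ', ← vnorm_sq]; positivity
  have hv0 : 0 ≤ v := by rw [← hvar, ← vnorm_sq]; positivity
  have h1 : |inner ℝ h (φx - Φa)| ≤ Real.sqrt v * ‖h‖ := by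
    refine (abs_real_inner_le_norm _ _).trans ?_
    rw [mul_comm]
    refine mul_le_mul_of_nonneg_right ?_ (norm_nonneg _)
    refine Real.le_sqrt_of_sq_le ?_
    rw [← hvar, ← vnorm_sq]
    have := sq_nonneg (s * vnorm a)
    nlinarith
  -- Cauchy–Schwarz in `H ⊕ ℝᵐ` for `(φx - Φa, s a)` and `(Φb, s⁻¹ K b)`: their inner product is `a
  -- ⬝ ε` by `haε`, and their squared norms are `v` and `Z`.
  have h2 : |a ⬝ᵥ ε| ≤ Real.sqrt v * Real.sqrt Z := by
    rw [← Real.sqrt_mul hv0, ← Real.sqrt_sq_eq_abs]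
    refine Real.sqrt_le_sqrt ?_
    rw [haε, ← hvar, ← hZ', ← vnorm_sq, ← vnorm_sq]
    have i1 := abs_real_inner_le_norm (φx - Φa) Φb
    have i2 : |a ⬝ᵥ (K *ᵥ b)| ≤ vnorm a * vnorm (K *ᵥ b) := by
      refine abs_le.mpr ⟨?_, dotProduct_le_vnorm _ _⟩
      have := dotProduct_le_vnorm (-a) (K *ᵥ b)
      rw [neg_dotProduct, vnorm_neg] at this
      linarith
    have i3 : |inner ℝ (φx - Φa) Φb + a ⬝ᵥ (K *ᵥ b)|
        ≤ ‖φx - Φa‖ * ‖Φb‖ + vnorm a * vnorm (K *ᵥ b) := (abs_add_le _ _).trans (add_le_add i1 i2)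
    have i4 := pow_le_pow_left₀ (abs_nonneg _) i3 2
    rw [sq_abs] at i4
    refine i4.trans ?_
    obtain ⟨q, hq⟩ : ∃ q, q = s⁻¹ * vnorm (K *ᵥ b) := ⟨_, rfl⟩
    have hq' : vnorm (K *ᵥ b) = s * q := by rw [hq]; field_simp
    have hq2 : (s ^ 2)⁻¹ * vnorm (K *ᵥ b) ^ 2 = q ^ 2 := by rw [hq', mul_pow]; field_simp
    rw [hq2, hq']
    nlinarith [sq_nonneg (‖φx - Φa‖ * q - s * vnorm a * ‖Φb‖)]
  refine ⟨?_, hZ ▸ hZ0⟩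
  rw [← hv, ← hZ, hsymW, ← ha]
  have hsplit : (fun j => inner ℝ h (φ j) + ε j) = (fun j => inner ℝ h (φ j)) + ε := rfl
  rw [hsplit, dotProduct_add, ← hinh, ← sub_sub, ← inner_sub_right, mul_add]
  exact (abs_sub _ _).trans (add_le_add h1 h2)

end ridge

/-! ### Concentration of sub-Gaussian quadratic forms -/

section concentration

variable {Ω : Type*} [MeasurableSpace Ω] {P : Measure Ω}

/-- Completing the square writes `exp (x² / 4)` as a Gaussian mixture of `exp (x y)`. After Tonelli,
the exponential moment of a square is thereby reduced to the moment generating function. -/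
theorem lintegral_exp_neg_sq_add_mul (x : ℝ) :
    ∫⁻ y : ℝ, ENNReal.ofReal (Real.exp (-y ^ 2 + y * x))
      = ENNReal.ofReal (Real.sqrt Real.pi) * ENNReal.ofReal (Real.exp (x ^ 2 / 4)) := by
  have e : ∀ y : ℝ, Real.exp (-y ^ 2 + y * x)
      = Real.exp (x ^ 2 / 4) * Real.exp (-1 * (y - x / 2) ^ 2) := by
    intro y
    rw [← Real.exp_add]; congr 1; ring
  simp only [e]
  have hint : Integrable (fun y : ℝ => Real.exp (-1 * y ^ 2)) :=
    integrable_exp_neg_mul_sq one_pos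
  rw [← ofReal_integral_eq_lintegral_ofReal ((hint.comp_sub_right (x / 2)).const_mul _)
    (Filter.Eventually.of_forall fun y => by positivity), integral_const_mul,
    integral_sub_right_eq_self (fun y : ℝ => Real.exp (-1 * y ^ 2)) (x / 2), integral_gaussian,
    div_one, mul_comm, ENNReal.ofReal_mul (by positivity)]

/-- The square of a sub-Gaussian variable has an exponential moment. -/
theorem lintegral_exp_sq_le {X : Ω → ℝ} (hX : Measurable X) [IsProbabilityMeasure P]
    (h : HasSubgaussianMGF X 1 P) :
    ∫⁻ ω, ENNReal.ofReal (Real.exp (X ω ^ 2 / 4)) ∂P ≤ ENNReal.ofReal (Real.sqrt 2) := by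
  have hπ : ENNReal.ofReal (Real.sqrt Real.pi) ≠ 0 := by
    simp [Real.pi_pos]
  refine (ENNReal.mul_le_mul_iff_right hπ ENNReal.ofReal_ne_top).mp ?_
  calc ENNReal.ofReal (Real.sqrt Real.pi)
        * ∫⁻ ω, ENNReal.ofReal (Real.exp (X ω ^ 2 / 4)) ∂P
      = ∫⁻ ω, ∫⁻ y : ℝ, ENNReal.ofReal (Real.exp (-y ^ 2 + y * X ω)) ∂volume ∂P := by
        rw [← lintegral_const_mul _ (by fun_prop)]
        exact lintegral_congr fun ω => (lintegral_exp_neg_sq_add_mul _).symm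
    _ = ∫⁻ y : ℝ, ∫⁻ ω, ENNReal.ofReal (Real.exp (-y ^ 2 + y * X ω)) ∂P ∂volume := by
        refine lintegral_lintegral_swap ?_
        exact Measurable.aemeasurable (by fun_prop)
    _ ≤ ∫⁻ y : ℝ, ENNReal.ofReal (Real.exp (-(1 / 2) * y ^ 2)) := by
        refine lintegral_mono fun y => ?_
        simp only [Real.exp_add]
        rw [← ofReal_integral_eq_lintegral_ofReal ((h.integrable_exp_mul y).const_mul _)
          (Filter.Eventually.of_forall fun ω => by positivity), integral_const_mul]
        refine ENNReal.ofReal_le_ofReal ?_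
        have hm := h.mgf_le y
        rw [mgf] at hm
        calc _ ≤ Real.exp (-y ^ 2) * Real.exp ((1 : ℝ≥0) * y ^ 2 / 2) := by gcongr
          _ = _ := by rw [← Real.exp_add]; congr 1; push_cast; ring
    _ = ENNReal.ofReal (Real.sqrt Real.pi) * ENNReal.ofReal (Real.sqrt 2) := by
        rw [← ofReal_integral_eq_lintegral_ofReal (integrable_exp_neg_mul_sq (by norm_num))
          (Filter.Eventually.of_forall fun y => by positivity), integral_gaussian,
          ← ENNReal.ofReal_mul (by positivity), ← Real.sqrt_mul Real.pi_pos.le]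
        congr 2; ring

/-- Tail bound for a positive quadratic form of independent sub-Gaussian variables in terms of its
trace. -/
theorem measureReal_quadForm_gt_le [IsProbabilityMeasure P] {m : ℕ} {ε : Fin m → Ω → ℝ} {s : ℝ}
    (hs : 0 < s) (hmeas : ∀ j, Measurable (ε j))
    (hsub : ∀ j, HasSubgaussianMGF (ε j) (s ^ 2).toNNReal P) (hind : iIndepFun ε P)
    {U : Matrix (Fin m) (Fin m) ℝ} (hU : Uᵀ * U = 1) {a : Fin m → ℝ} (ha : ∀ k, 0 ≤ a k)
    (hτ : 0 < ∑ k, a k) (t : ℝ) :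
    P.real {ω | t < (s ^ 2)⁻¹ * ∑ k, a k * (∑ j, U j k * ε j ω) ^ 2}
      ≤ Real.sqrt 2 * Real.exp (-(t / (4 * ∑ k, a k))) := by
  obtain ⟨τ, hτd⟩ : ∃ τ, τ = ∑ k, a k := ⟨_, rfl⟩
  rw [← hτd] at hτ ⊢
  have hw : ∑ k, a k / τ = 1 := by rw [← Finset.sum_div, ← hτd]; field_simp
  -- The normalized noise coordinates in the eigenbasis. The columns of `U` are unit vectors, so
  -- each coordinate has variance proxy `1`.
  obtain ⟨X, hXd⟩ : ∃ X : Fin m → Ω → ℝ, X = fun k ω => ∑ j, (U j k / s) * ε j ω := ⟨_, rfl⟩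
  have hXm : ∀ k, Measurable (X k) := by
    intro k; rw [hXd]; fun_prop
  have hXs : ∀ k, HasSubgaussianMGF (X k) 1 P := by
    intro k
    have hind' : iIndepFun (fun j ω => (U j k / s) * ε j ω) P :=
      hind.comp (fun j x => (U j k / s) * x) fun j => by fun_prop
    have h1 := HasSubgaussianMGF.sum_of_iIndepFun hind' (s := Finset.univ)
      fun j _ => (hsub j).const_mul (U j k / s)
    rw [hXd]
    convert h1 using 1
    apply NNReal.eq
    have hUk : ∑ j, U j k * U j k = 1 := by
      have := congrFun (congrFun hU k) k
      simpa [Matrix.mul_apply] using this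
    rw [NNReal.coe_sum, NNReal.coe_one, ← hUk]
    refine Finset.sum_congr rfl fun j _ => ?_
    change _ = (U j k / s) ^ 2 * ((s ^ 2).toNNReal : ℝ)
    rw [Real.coe_toNNReal _ (by positivity)]
    field_simp
  obtain ⟨Z, hZd⟩ : ∃ Z : Ω → ℝ, Z = fun ω =>
    (s ^ 2)⁻¹ * ∑ k, a k * (∑ j, U j k * ε j ω) ^ 2 := ⟨_, rfl⟩
  have hZm : Measurable Z := by rw [hZd]; fun_prop
  have hZ : ∀ ω, Z ω / (4 * τ) = ∑ k, a k / τ * (X k ω ^ 2 / 4) := by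
    intro ω
    rw [hZd, hXd]
    simp only [Finset.mul_sum, Finset.sum_div]
    refine Finset.sum_congr rfl fun k _ => ?_
    have : ∑ j, U j k / s * ε j ω = s⁻¹ * ∑ j, U j k * ε j ω := by
      rw [Finset.mul_sum]
      exact Finset.sum_congr rfl fun j _ => by ring
    rw [this]
    field_simp
  -- Jensen with the weights `a k / τ`. It replaces any independence between the coordinates `X k`,
  -- which need not hold for sub-Gaussian noise.
  have hconv : ∀ ω, Real.exp (Z ω / (4 * τ)) ≤ ∑ k, a k / τ * Real.exp (X k ω ^ 2 / 4) := by
    intro ω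
    rw [hZ]
    have := convexOn_exp.map_sum_le (t := Finset.univ) (w := fun k => a k / τ)
      (p := fun k => X k ω ^ 2 / 4) (fun k _ => div_nonneg (ha k) hτ.le) hw
      (fun _ _ => Set.mem_univ _)
    simpa only [smul_eq_mul] using this
  have hmom : ∫⁻ ω, ENNReal.ofReal (Real.exp (Z ω / (4 * τ))) ∂P ≤ ENNReal.ofReal (Real.sqrt 2) := by
    calc ∫⁻ ω, ENNReal.ofReal (Real.exp (Z ω / (4 * τ))) ∂P
        ≤ ∫⁻ ω, ∑ k, ENNReal.ofReal (a k / τ) * ENNReal.ofReal (Real.exp (X k ω ^ 2 / 4)) ∂P := by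
          refine lintegral_mono fun ω => ?_
          refine (ENNReal.ofReal_le_ofReal (hconv ω)).trans_eq ?_
          rw [ENNReal.ofReal_sum_of_nonneg fun k _ =>
            mul_nonneg (div_nonneg (ha k) hτ.le) (Real.exp_nonneg _)]
          exact Finset.sum_congr rfl fun k _ => ENNReal.ofReal_mul (div_nonneg (ha k) hτ.le)
      _ = ∑ k, ENNReal.ofReal (a k / τ) * ∫⁻ ω, ENNReal.ofReal (Real.exp (X k ω ^ 2 / 4)) ∂P := by
          have hXk : ∀ k, Measurable (X k) := hXm
          rw [lintegral_finsetSum _ fun k _ => by have := hXk k; fun_prop]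
          refine Finset.sum_congr rfl fun k _ => ?_
          have := hXk k
          rw [lintegral_const_mul _ (by fun_prop)]
      _ ≤ ∑ k, ENNReal.ofReal (a k / τ) * ENNReal.ofReal (Real.sqrt 2) := by
          gcongr with k
          exact lintegral_exp_sq_le (hXm k) (hXs k)
      _ = ENNReal.ofReal (Real.sqrt 2) := by
          rw [← Finset.sum_mul, ← ENNReal.ofReal_sum_of_nonneg fun k _ => div_nonneg (ha k) hτ.le,
            hw, ENNReal.ofReal_one, one_mul]
  have hsubset : {ω | t < Z ω} ⊆ {ω | ENNReal.ofReal (Real.exp (t / (4 * τ)))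
      ≤ ENNReal.ofReal (Real.exp (Z ω / (4 * τ)))} := by
    intro ω hω
    refine ENNReal.ofReal_le_ofReal (Real.exp_le_exp.mpr ?_)
    have : t < Z ω := hω
    gcongr
  have hmarkov := mul_meas_ge_le_lintegral (μ := P)
    (f := fun ω => ENNReal.ofReal (Real.exp (Z ω / (4 * τ)))) (by fun_prop)
    (ENNReal.ofReal (Real.exp (t / (4 * τ))))
  have hfin := (mul_le_mul_right (measure_mono (μ := P) hsubset)
    (ENNReal.ofReal (Real.exp (t / (4 * τ))))).trans (hmarkov.trans hmom)
  have hreal := ENNReal.toReal_mono ENNReal.ofReal_ne_top hfin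
  rw [ENNReal.toReal_mul, ENNReal.toReal_ofReal (Real.exp_nonneg _),
    ENNReal.toReal_ofReal (Real.sqrt_nonneg _)] at hreal
  change Real.exp (t / (4 * τ)) * P.real {ω | t < Z ω} ≤ _ at hreal
  rw [hZd] at hreal
  rw [Real.exp_neg]
  calc _ = (Real.exp (t / (4 * τ)))⁻¹ * (Real.exp (t / (4 * τ))
        * P.real {ω | t < (s ^ 2)⁻¹ * ∑ k, a k * (∑ j, U j k * ε j ω) ^ 2}) := by
        field_simp
    _ ≤ (Real.exp (t / (4 * τ)))⁻¹ * Real.sqrt 2 := by gcongr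
    _ = _ := mul_comm _ _

end concentration

/-! ### Gaussian process regression in a reproducing kernel Hilbert space -/

/-- A function in a scalar reproducing kernel Hilbert space is represented by a feature map. -/
theorem HasRKHSNorm.exists_features {X : Type} {k : X → X → ℝ} {f : X → ℝ} {B : ℝ}
    (hf : HasRKHSNorm k f B) :
    ∃ (H : Type) (_ : NormedAddCommGroup H) (_ : InnerProductSpace ℝ H) (φ : X → H) (h : H),
      (∀ x y, inner ℝ (φ x) (φ y) = k x y) ∧ (∀ x, inner ℝ h (φ x) = f x) ∧ ‖h‖ = B := by
  obtain ⟨H, i1, i2, i3, i4, hk, h, hh, hB⟩ := hf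
  refine ⟨H, i1, i2, fun x => RKHS.kerFun H x (1 : ℝ), h, fun x y => ?_, fun x => ?_, hB⟩
  · rw [real_inner_comm, ← RKHS.kernel_inner, hk]
    simp
  · rw [RKHS.inner_kerFun, hh]
    simp

namespace GPModel

variable (G : GPModel) {D : Set (Fin 3 → ℝ)}

theorem quadForm_nonneg (z : Vec6) : 0 ≤ z ⬝ᵥ (G.Λ *ᵥ z) := by
  have := G.Λ_psd.dotProduct_mulVec_nonneg z
  rwa [star_trivial] at this

theorem kernel_nonneg (x y : Vec6) : 0 ≤ G.kernel x y := by
  unfold kernel; positivity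

theorem kernel_le (x y : Vec6) : G.kernel x y ≤ G.σf ^ 2 := by
  have h := G.quadForm_nonneg (x - y)
  refine mul_le_of_le_one_right (sq_nonneg _) (Real.exp_le_one_iff.mpr ?_)
  linarith

theorem kernel_self (x : Vec6) : G.kernel x x = G.σf ^ 2 := by
  simp [kernel]

/-- The quadratic form of the noise in the prediction error of output `i`. -/
def noiseForm (i : I6) (ε : Fin G.M → ℝ) : ℝ :=
  (G.σn i ^ 2)⁻¹ * ε ⬝ᵥ (G.gram G.input *ᵥ ((G.regGram i)⁻¹ *ᵥ ε))

/-- A real `sSup` dominates its members only if the set is bounded. Here the entries of the matrix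
are at most `1 + σf² / σn²`, which bounds the determinant and hence its logarithm. -/
theorem bddAbove_infoGain (D : Set (Fin 3 → ℝ)) (i : I6) :
    BddAbove {γ | ∃ a : Fin G.M → Vec6, (∀ j, a j ∈ poseDomain D) ∧
      γ = 1 / 2 * Real.log (1 + (G.σn i ^ 2)⁻¹ • G.gram a).det} := by
  have hσ := G.σn_pos i
  refine ⟨1 / 2 * ((Fintype.card (Fin G.M)).factorial •
    (1 + (G.σn i ^ 2)⁻¹ * G.σf ^ 2) ^ Fintype.card (Fin G.M)), ?_⟩
  rintro γ ⟨a, -, rfl⟩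
  refine mul_le_mul_of_nonneg_left ?_ (by norm_num)
  rw [← Real.log_abs]
  refine (Real.log_le_self (abs_nonneg _)).trans ?_
  refine Matrix.det_le (abv := AbsoluteValue.abs) fun j j' => ?_
  have h0 := G.kernel_nonneg (a j) (a j')
  have h1 := G.kernel_le (a j) (a j')
  have h2 : 0 ≤ (1 : Matrix (Fin G.M) (Fin G.M) ℝ) j j' ∧
      (1 : Matrix (Fin G.M) (Fin G.M) ℝ) j j' ≤ 1 := by
    rw [Matrix.one_apply]; split_ifs <;> norm_num
  have h3 : (G.σn i ^ 2)⁻¹ * G.kernel (a j) (a j') ≤ (G.σn i ^ 2)⁻¹ * G.σf ^ 2 := by gcongr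
  have h4 : 0 ≤ (G.σn i ^ 2)⁻¹ * G.kernel (a j) (a j') := by positivity
  change |(1 : Matrix (Fin G.M) (Fin G.M) ℝ) j j' + (G.σn i ^ 2)⁻¹ * G.kernel (a j) (a j')| ≤ _
  rw [abs_of_nonneg (add_nonneg h2.1 h4)]
  exact add_le_add h2.2 h3

theorem log_det_le_maxInfoGain (hinput : ∀ j, G.input j ∈ poseDomain D) (i : I6) :
    Real.log (1 + (G.σn i ^ 2)⁻¹ • G.gram G.input).det ≤ 2 * G.maxInfoGain D i := by
  have := le_csSup (G.bddAbove_infoGain D i) ⟨G.input, hinput, rfl⟩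
  rw [maxInfoGain]
  linarith

/-- Diagonal form of the noise term, with a trace controlled by the information gain. -/
theorem exists_noiseForm_eq_sum (hinput : ∀ j, G.input j ∈ poseDomain D)
    (hpsd : (G.gram G.input).PosSemidef) (i : I6) :
    ∃ (U : Matrix (Fin G.M) (Fin G.M) ℝ) (a : Fin G.M → ℝ), Uᵀ * U = 1 ∧ (∀ k, 0 ≤ a k) ∧
      ∑ k, a k ≤ 2 * G.maxInfoGain D i ∧
      ∀ ε, G.noiseForm i ε = (G.σn i ^ 2)⁻¹ * ∑ k, a k * (∑ j, U j k * ε j) ^ 2 := by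
  obtain ⟨U, l, hU, hl, hK⟩ := exists_diagonalization hpsd
  have hσ : 0 < G.σn i ^ 2 := pow_pos (G.σn_pos i) 2
  refine ⟨U, fun k => l k / (l k + G.σn i ^ 2), hU,
    fun k => div_nonneg (hl k) (add_nonneg (hl k) hσ.le), ?_, fun ε => ?_⟩
  · refine le_trans ?_ (G.log_det_le_maxInfoGain hinput i)
    have hpos : ∀ k, 0 < 1 + (G.σn i ^ 2)⁻¹ * l k := fun k => by
      have := hl k; positivity
    rw [hK, det_one_add_smul_diagonalization _ hU, Real.log_prod fun k _ => (hpos k).ne']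
    refine Finset.sum_le_sum fun k _ => ?_
    -- With `x = l / σn²`, the trace weight `l / (l + σn²)` equals `1 - 1 / (1 + x)`, which is at
    -- most `log (1 + x)`.
    have h := Real.one_sub_inv_le_log_of_pos (hpos k)
    refine le_trans (le_of_eq ?_) h
    have h2 : l k + G.σn i ^ 2 ≠ 0 := (add_pos_of_nonneg_of_pos (hl k) hσ).ne'
    have h3 : 1 + (G.σn i ^ 2)⁻¹ * l k = (l k + G.σn i ^ 2) / G.σn i ^ 2 := by
      rw [add_div, div_self hσ.ne']; ring
    rw [h3, inv_div]
    field_simp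
    ring
  · rw [noiseForm, regGram, hK, dotProduct_mul_inv_mulVec hσ hU hl]

end GPModel

/-! ### Scalar estimates from the reproducing property -/

section regression

variable {D : Set (Fin 3 → ℝ)} {G : GPModel} {f : Vec6 → ℝ} {B : ℝ}

theorem gram_posSemidef (hinput : ∀ j, G.input j ∈ poseDomain D)
    (hf : HasRKHSNorm (fun x y : poseDomain D => G.kernel x y) (fun x : poseDomain D => f x) B) :
    (G.gram G.input).PosSemidef := by
  obtain ⟨H, _, _, φ, h, hφ, -, -⟩ := hf.exists_features
  have : G.gram G.input = Matrix.gram ℝ fun j => φ ⟨G.input j, hinput j⟩ := by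
    ext j j'
    rw [Matrix.gram_apply, hφ]
    rfl
  rw [this]
  exact Matrix.posSemidef_gram ℝ _

theorem abs_sub_mean_le (hinput : ∀ j, G.input j ∈ poseDomain D)
    (hf : HasRKHSNorm (fun x y : poseDomain D => G.kernel x y) (fun x : poseDomain D => f x) B)
    {Y : Fin G.M → Vec6} {ε : Fin G.M → ℝ} {i : I6} (hY : ∀ j, Y j i = f (G.input j) + ε j)
    {x : Vec6} (hx : x ∈ poseDomain D) :
    |f x - G.mean Y x i| ≤ Real.sqrt (G.var x i) * (B + Real.sqrt (G.noiseForm i ε)) ∧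
      0 ≤ G.noiseForm i ε := by
  obtain ⟨H, _, _, φ, h, hφ, hh, rfl⟩ := hf.exists_features
  have hK : G.gram G.input = Matrix.gram ℝ fun j => φ ⟨G.input j, hinput j⟩ := by
    ext j j'
    rw [Matrix.gram_apply, hφ]
    rfl
  have hk : G.cov x = fun j => inner ℝ (φ ⟨G.input j, hinput j⟩) (φ ⟨x, hx⟩) := by
    ext j
    rw [hφ]
    rfl
  have key := ridge_error_le (fun j => φ ⟨G.input j, hinput j⟩) (φ ⟨x, hx⟩) h ε (G.σn_pos i) hK
    (W := (G.regGram i)⁻¹) rfl hk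
  simp only [hφ, hh] at key
  have hY' : (fun j => Y j i) = fun j => f (G.input j) + ε j := funext hY
  rw [GPModel.mean, hY']
  exact key

theorem abs_le_of_hasRKHSNorm
    (hf : HasRKHSNorm (fun x y : poseDomain D => G.kernel x y) (fun x : poseDomain D => f x) B)
    {x : Vec6} (hx : x ∈ poseDomain D) : |f x| ≤ B * |G.σf| := by
  obtain ⟨H, _, _, φ, h, hφ, hh, rfl⟩ := hf.exists_features
  have h1 := abs_real_inner_le_norm h (φ ⟨x, hx⟩)
  rw [hh] at h1
  refine h1.trans (mul_le_mul_of_nonneg_left ?_ (norm_nonneg _))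
  refine abs_le_of_sq_le_sq' ?_ (abs_nonneg _) |>.2
  rw [sq_abs, ← real_inner_self_eq_norm_sq, hφ, G.kernel_self]

theorem quadForm_le (Λ : Matrix I6 I6 ℝ) (z : Vec6) :
    z ⬝ᵥ (Λ *ᵥ z) ≤ (∑ i, ∑ j, |Λ i j|) * vnorm z ^ 2 := by
  simp only [dotProduct, Matrix.mulVec, Finset.mul_sum, Finset.sum_mul]
  refine Finset.sum_le_sum fun i _ => Finset.sum_le_sum fun j _ => ?_
  refine (le_abs_self _).trans ?_
  rw [abs_mul, abs_mul]
  have h1 := abs_le_vnorm z i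
  have h2 := abs_le_vnorm z j
  calc |z i| * (|Λ i j| * |z j|) = |Λ i j| * (|z i| * |z j|) := by ring
    _ ≤ |Λ i j| * (vnorm z * vnorm z) := by gcongr; exact vnorm_nonneg _
    _ = _ := by ring

/-- The feature map is Lipschitz: with `q` the quadratic form of `x - y`, `‖φ x - φ y‖² = 2 σf² (1 -
exp (-q / 2)) ≤ σf² q`. -/
theorem abs_sub_le_of_hasRKHSNorm
    (hf : HasRKHSNorm (fun x y : poseDomain D => G.kernel x y) (fun x : poseDomain D => f x) B)
    {x y : Vec6} (hx : x ∈ poseDomain D) (hy : y ∈ poseDomain D) :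
    |f x - f y| ≤ B * |G.σf| * Real.sqrt (∑ i, ∑ j, |G.Λ i j|) * vnorm (x - y) := by
  obtain ⟨H, _, _, φ, h, hφ, hh, rfl⟩ := hf.exists_features
  have h1 := abs_real_inner_le_norm h (φ ⟨x, hx⟩ - φ ⟨y, hy⟩)
  rw [inner_sub_right, hh, hh] at h1
  refine h1.trans ?_
  rw [mul_assoc, mul_assoc]
  refine mul_le_mul_of_nonneg_left ?_ (norm_nonneg _)
  have hq0 : 0 ≤ ∑ i, ∑ j, |G.Λ i j| :=
    Finset.sum_nonneg fun i _ => Finset.sum_nonneg fun j _ => abs_nonneg _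
  have h3 := quadForm_le G.Λ (x - y)
  generalize ∑ i, ∑ j, |G.Λ i j| = q at hq0 h3 ⊢
  have hnn : 0 ≤ |G.σf| * (Real.sqrt q * vnorm (x - y)) :=
    mul_nonneg (abs_nonneg _) (mul_nonneg (Real.sqrt_nonneg _) (vnorm_nonneg _))
  rw [← sq_le_sq₀ (norm_nonneg _) hnn, mul_pow, mul_pow, sq_abs, Real.sq_sqrt hq0]
  have hsymm : G.kernel y x = G.kernel x y := by
    have := real_inner_comm (φ ⟨x, hx⟩) (φ ⟨y, hy⟩)
    rwa [hφ, hφ] at this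
  rw [← real_inner_self_eq_norm_sq, inner_sub_left, inner_sub_right, inner_sub_right, hφ, hφ, hφ,
    hφ, G.kernel_self, G.kernel_self, hsymm]
  have h2 := Real.add_one_le_exp (-(1 / 2) * ((x - y) ⬝ᵥ (G.Λ *ᵥ (x - y))))
  rw [GPModel.kernel]
  nlinarith [mul_le_mul_of_nonneg_left h2 (sq_nonneg G.σf),
    mul_le_mul_of_nonneg_left h3 (sq_nonneg G.σf)]

end regression

/-! ### Estimates for the vector-valued motion profiles -/

section profile

variable {D : Set (Fin 3 → ℝ)} {G : GPModel} {V : SE3 → Vec6} {B : Vec6}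

theorem exists_lipschitz_vectorForm
    (hB : ∀ i, HasRKHSNorm (fun x y : poseDomain D => G.kernel x y)
      (fun x : poseDomain D => V (poseOf x) i) (B i)) :
    ∃ C : ℝ, 0 ≤ C ∧ ∀ x ∈ poseDomain D, ∀ y ∈ poseDomain D,
      vnorm (V (poseOf x) - V (poseOf y)) ≤ C * vnorm (x - y) := by
  refine ⟨|∑ i, B i * |G.σf| * Real.sqrt (∑ i, ∑ j, |G.Λ i j|)|, abs_nonneg _,
    fun x hx y hy => ?_⟩
  refine (vnorm_le_sum _).trans (le_trans ?_
    (mul_le_mul_of_nonneg_right (le_abs_self _) (vnorm_nonneg _)))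
  rw [Finset.sum_mul]
  exact Finset.sum_le_sum fun i _ =>
    abs_sub_le_of_hasRKHSNorm (f := fun x => V (poseOf x) i) (hB i) hx hy

/-- The kernel is bounded, so this holds for arbitrary training outputs. Ultimate boundedness thus
needs no confidence event. -/
theorem exists_bound_sub_mean
    (hB : ∀ i, HasRKHSNorm (fun x y : poseDomain D => G.kernel x y)
      (fun x : poseDomain D => V (poseOf x) i) (B i)) (Y : Fin G.M → Vec6) :
    ∃ C : ℝ, ∀ x ∈ poseDomain D, vnorm (V (poseOf x) - G.mean Y x) ≤ C := by
  refine ⟨∑ i, (B i * |G.σf| + ∑ j, G.σf ^ 2 * |((G.regGram i)⁻¹ *ᵥ fun j => Y j i) j|),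
    fun x hx => (vnorm_le_sum _).trans (Finset.sum_le_sum fun i _ => ?_)⟩
  refine (abs_sub _ _).trans (add_le_add
    (abs_le_of_hasRKHSNorm (f := fun x => V (poseOf x) i) (hB i) hx) ?_)
  rw [GPModel.mean, dotProduct]
  refine (Finset.abs_sum_le_sum_abs _ _).trans (Finset.sum_le_sum fun j _ => ?_)
  rw [abs_mul]
  refine mul_le_mul_of_nonneg_right ?_ (abs_nonneg _)
  rw [GPModel.cov, abs_of_nonneg (G.kernel_nonneg _ _)]
  exact G.kernel_le _ _

/-- The uniform error bound, on the event that the noise terms are small. -/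
theorem vnorm_sub_mean_le_errBound (hinput : ∀ j, G.input j ∈ poseDomain D)
    (hB : ∀ i, HasRKHSNorm (fun x y : poseDomain D => G.kernel x y)
      (fun x : poseDomain D => V (poseOf x) i) (B i))
    {Y : Fin G.M → Vec6} {ε : Fin G.M → I6 → ℝ}
    (hY : ∀ j i, Y j i = V (poseOf (G.input j)) i + ε j i) {δ : ℝ}
    (hgood : ∀ i, 2 * G.noiseForm i (fun j => ε j i)
      ≤ 300 * G.maxInfoGain D i * Real.log ((G.M + 1) / δ) ^ 3)
    {x : Vec6} (hx : x ∈ poseDomain D) :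
    vnorm (V (poseOf x) - G.mean Y x) ≤ G.errBound D B δ x := by
  refine vnorm_mono fun i => ?_
  obtain ⟨h1, h2⟩ := abs_sub_mean_le (f := fun x => V (poseOf x) i) hinput (hB i)
    (fun j => hY j i) hx
  refine h1.trans (le_trans ?_ (le_abs_self _))
  rw [GPModel.sqrtVar, Matrix.vecMul_diagonal, mul_comm]
  refine mul_le_mul_of_nonneg_right ?_ (Real.sqrt_nonneg _)
  refine Real.le_sqrt_of_sq_le ?_
  have h3 := hgood i
  have h4 := Real.sq_sqrt h2
  -- From `(B + √Z)² ≤ 2 B² + 2 Z`; the event bounds `2 Z` by the second term under the root in `β`.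
  nlinarith [sq_nonneg (B i - Real.sqrt (G.noiseForm i fun j => ε j i))]

theorem GPModel.continuous_kernel (x : Vec6) : Continuous (G.kernel x) := by
  unfold GPModel.kernel
  refine Continuous.mul continuous_const (Real.continuous_exp.comp (Continuous.mul continuous_const ?_))
  have h1 : Continuous fun x' => x - x' := continuous_const.sub continuous_id
  exact h1.dotProduct (Continuous.matrix_mulVec continuous_const h1)

theorem GPModel.continuous_errBound (δ : ℝ) : Continuous (G.errBound D B δ) := by
  refine continuous_vnorm.comp (continuous_pi fun i => ?_)
  simp only [GPModel.sqrtVar, Matrix.vecMul_diagonal, GPModel.var, G.kernel_self]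
  have hc : Continuous G.cov := continuous_pi fun j => G.continuous_kernel _
  exact continuous_const.mul (Real.continuous_sqrt.comp (continuous_const.sub
    (hc.dotProduct (Continuous.matrix_mulVec continuous_const hc))))

end profile

/-! ### The probability of the confidence events -/

section probability

variable {Ω : Type*} [MeasurableSpace Ω] {P : Measure Ω} [IsProbabilityMeasure P]
  {D : Set (Fin 3 → ℝ)} {G : GPModel} {δ : ℝ}

theorem measureReal_noiseForm_gt_le (hinput : ∀ j, G.input j ∈ poseDomain D)
    (hpsd : (G.gram G.input).PosSemidef) {i : I6} {ε : Fin G.M → Ω → ℝ}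
    (hmeas : ∀ j, Measurable (ε j))
    (hsub : ∀ j, HasSubgaussianMGF (ε j) (G.σn i ^ 2).toNNReal P) (hind : iIndepFun ε P)
    (hδ0 : 0 < δ) (hδ1 : δ < 1) :
    P.real {ω | 300 * G.maxInfoGain D i * Real.log ((G.M + 1) / δ) ^ 3
      < 2 * G.noiseForm i fun j => ε j ω} ≤ δ ^ 6 / 6 := by
  obtain ⟨U, a, hU, ha, hγ, hZ⟩ := G.exists_noiseForm_eq_sum hinput hpsd i
  obtain ⟨γ, hγd⟩ : ∃ γ, γ = G.maxInfoGain D i := ⟨_, rfl⟩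
  obtain ⟨w, hw⟩ : ∃ w, w = Real.log ((G.M + 1) / δ) := ⟨_, rfl⟩
  simp only [hZ]
  rw [← hγd] at hγ ⊢
  rw [← hw]
  have hτ0 : 0 ≤ ∑ k, a k := Finset.sum_nonneg fun k _ => ha k
  have hγ0 : 0 ≤ γ := by linarith
  -- If the trace vanishes, as it does without data, the noise form is zero and the event is empty.
  -- Otherwise there is at least one data point, so `w ≥ log 2`.
  rcases hτ0.eq_or_lt with hτ | hτ
  · have ha0 : ∀ k, a k = 0 := fun k =>
      (Finset.sum_eq_zero_iff_of_nonneg fun k _ => ha k).mp hτ.symm k (Finset.mem_univ k)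
    have hw0 : 0 ≤ w := by
      rw [hw]
      refine Real.log_nonneg ((one_le_div hδ0).mpr ?_)
      have : (0 : ℝ) ≤ G.M := Nat.cast_nonneg _
      linarith
    have hempty : {ω | 300 * γ * w ^ 3 < 2 * ((G.σn i ^ 2)⁻¹
        * ∑ k, a k * (∑ j, U j k * ε j ω) ^ 2)} = ∅ := by
      ext ω
      simp only [ha0, zero_mul, Finset.sum_const_zero, mul_zero, Set.mem_ofPred_eq,
        Set.mem_empty_iff_false, iff_false, not_lt]
      positivity
    rw [hempty, measureReal_empty]
    positivity
  · have hM : (1 : ℝ) ≤ G.M := by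
      rw [Nat.one_le_cast, Nat.one_le_iff_ne_zero]
      intro h0
      have : IsEmpty (Fin G.M) := by rw [h0]; infer_instance
      rw [Finset.univ_eq_empty, Finset.sum_empty] at hτ
      exact lt_irrefl _ hτ
    have hγ1 : 0 < γ := by linarith
    have hMδ : 0 < (G.M + 1) / δ := by positivity
    have hw1 : 0.69 ≤ w := by
      rw [hw]
      refine le_trans (by have := Real.log_two_gt_d9; linarith) (Real.log_le_log two_pos ?_)
      rw [le_div_iff₀ hδ0]
      nlinarith
    have hset : {ω | 300 * γ * w ^ 3 < 2 * ((G.σn i ^ 2)⁻¹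
        * ∑ k, a k * (∑ j, U j k * ε j ω) ^ 2)} = {ω | 150 * γ * w ^ 3 < (G.σn i ^ 2)⁻¹
        * ∑ k, a k * (∑ j, U j k * ε j ω) ^ 2} := by
      ext ω
      simp only [Set.mem_ofPred_eq]
      constructor <;> intro h <;> linarith
    rw [hset]
    refine (measureReal_quadForm_gt_le (G.σn_pos i) hmeas hsub hind hU ha hτ _).trans ?_
    -- Uses trace `≤ 2 γ` and `150 w² ≥ 150 * 0.47 > 64`. The exponent `8` gives a tail of at most
    -- `2 (δ / 2)⁸ = δ⁸ / 128`, below the share `δ⁶ / 6` of one of the six outputs.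
    have h8 : 8 * w ≤ 150 * γ * w ^ 3 / (4 * ∑ k, a k) := by
      rw [le_div_iff₀ (by positivity)]
      have hw2 : 0.47 ≤ w ^ 2 := by nlinarith
      calc 8 * w * (4 * ∑ k, a k) ≤ 8 * w * (4 * (2 * γ)) := by gcongr
        _ = γ * w * 64 := by ring
        _ ≤ γ * w * (150 * w ^ 2) := by
          refine mul_le_mul_of_nonneg_left ?_ (by positivity)
          linarith
        _ = _ := by ring
    have hexp : Real.exp (-w) ≤ δ / 2 := by
      rw [Real.exp_neg, hw, Real.exp_log hMδ, inv_div]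
      gcongr
      linarith
    have hexp8 : Real.exp (-(150 * γ * w ^ 3 / (4 * ∑ k, a k))) ≤ (δ / 2) ^ 8 := by
      calc Real.exp (-(150 * γ * w ^ 3 / (4 * ∑ k, a k))) ≤ Real.exp ((8 : ℕ) * -w) := by
            refine Real.exp_le_exp.mpr ?_
            push_cast
            linarith
        _ = Real.exp (-w) ^ 8 := Real.exp_nat_mul _ _
        _ ≤ _ := by gcongr
    have hsqrt : Real.sqrt 2 ≤ 2 := by
      rw [Real.sqrt_le_left two_pos.le]; norm_num
    calc _ ≤ 2 * (δ / 2) ^ 8 := by gcongr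
      _ = δ ^ 6 * (δ ^ 2 / 128) := by ring
      _ ≤ δ ^ 6 * (1 / 6) := by
        refine mul_le_mul_of_nonneg_left ?_ (by positivity)
        nlinarith
      _ = _ := by ring

/-- The event on which the noise terms of all outputs are small. -/
def confidenceEvent (D : Set (Fin 3 → ℝ)) (G : GPModel) (δ : ℝ) (ε : Fin G.M → I6 → Ω → ℝ) :
    Set Ω :=
  {ω | ∀ i, 2 * G.noiseForm i (fun j => ε j i ω)
    ≤ 300 * G.maxInfoGain D i * Real.log ((G.M + 1) / δ) ^ 3}

theorem measurableSet_confidenceEvent {ε : Fin G.M → I6 → Ω → ℝ}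
    (hmeas : ∀ j i, Measurable (ε j i)) : MeasurableSet (confidenceEvent D G δ ε) := by
  simp only [confidenceEvent, Set.ofPred_forall]
  refine MeasurableSet.iInter fun i => measurableSet_le ?_ measurable_const
  unfold GPModel.noiseForm
  simp only [dotProduct, Matrix.mulVec]
  fun_prop

/-- A union bound over the six outputs, so no independence between outputs is needed. -/
theorem le_measureReal_confidenceEvent (hinput : ∀ j, G.input j ∈ poseDomain D)
    (hpsd : (G.gram G.input).PosSemidef) {ε : Fin G.M → I6 → Ω → ℝ}
    (hmeas : ∀ j i, Measurable (ε j i))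
    (hsub : ∀ j i, HasSubgaussianMGF (ε j i) (G.σn i ^ 2).toNNReal P)
    (hind : ∀ i, iIndepFun (fun j => ε j i) P) (hδ0 : 0 < δ) (hδ1 : δ < 1) :
    1 - δ ^ 6 ≤ P.real (confidenceEvent D G δ ε) := by
  have hm := measurableSet_confidenceEvent (D := D) (δ := δ) hmeas
  have hc : (confidenceEvent D G δ ε)ᶜ = ⋃ i ∈ (Finset.univ : Finset I6),
      {ω | 300 * G.maxInfoGain D i * Real.log ((G.M + 1) / δ) ^ 3
        < 2 * G.noiseForm i fun j => ε j i ω} := by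
    ext ω
    simp only [confidenceEvent, Set.mem_compl_iff, Set.mem_ofPred_eq, not_forall, not_le,
      Set.mem_iUnion, Finset.mem_univ, exists_prop, true_and]
  have h1 : P.real (confidenceEvent D G δ ε)ᶜ ≤ ∑ i : I6, δ ^ 6 / 6 := by
    rw [hc]
    exact (measureReal_biUnion_finset_le _ _).trans (Finset.sum_le_sum fun i _ =>
      measureReal_noiseForm_gt_le hinput hpsd (fun j => hmeas j i) (fun j => hsub j i) (hind i)
        hδ0 hδ1)
  rw [measureReal_compl hm, probReal_univ] at h1
  simp at h1
  linarith

end probability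

/-! ### The Lipschitz property with respect to the estimation error -/

section axis

variable {ξ : Fin 3 → ℝ}

theorem hat_smul (c : ℝ) (a : Fin 3 → ℝ) : hat (c • a) = c • hat a := by
  ext i j; fin_cases i <;> fin_cases j <;> simp [hat]

theorem rodrigues_smul (hξ : vnorm ξ = 1) (θ : ℝ) :
    rodrigues (θ • ξ) = 1 + Real.sin θ • hat ξ + (1 - Real.cos θ) • (hat ξ * hat ξ) := by
  rw [rodrigues, vnorm_smul, hξ, mul_one, hat_smul, Real.cos_abs, sq_abs]
  rcases eq_or_ne θ 0 with rfl | hθ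
  · simp
  have h1 : Real.sin |θ| / |θ| * θ = Real.sin θ := by
    rcases abs_cases θ with ⟨h, -⟩ | ⟨h, -⟩
    · rw [h]; field_simp
    · rw [h, Real.sin_neg]; field_simp
  have h2 : (1 - Real.cos θ) / θ ^ 2 * θ * θ = 1 - Real.cos θ := by field_simp
  rw [Matrix.smul_mul, Matrix.mul_smul, smul_smul, smul_smul, smul_smul, h1, h2]

theorem rotVec_smul_congr (hξ : vnorm ξ = 1) {θ θ' : ℝ} (hs : Real.sin θ = Real.sin θ')
    (hc : Real.cos θ = Real.cos θ') : rotVec (θ • ξ) = rotVec (θ' • ξ) := by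
  apply Subtype.ext
  change rodrigues _ = rodrigues _
  rw [rodrigues_smul hξ, rodrigues_smul hξ, hs, hc]

theorem AboutAxis.exists_abs_le_pi (hξ : vnorm ξ = 1) {R : SO3} (hR : AboutAxis ξ R) :
    ∃ θ : ℝ, |θ| ≤ Real.pi ∧ R = rotVec (θ • ξ) := by
  obtain ⟨θ, rfl⟩ := hR
  refine ⟨(θ : Real.Angle).toReal, Real.Angle.abs_toReal_le_pi _, rotVec_smul_congr hξ ?_ ?_⟩
  · rw [Real.Angle.sin_toReal, Real.Angle.sin_coe]
  · rw [Real.Angle.cos_toReal, Real.Angle.cos_coe]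

/-- Rotations about a common axis compose by adding angles, so the relative angle is `θ - θ'`. -/
theorem cosAngle_inv_mul_rotVec (hξ : vnorm ξ = 1) (θ θ' : ℝ) :
    cosAngle ((rotVec (θ' • ξ))⁻¹ * rotVec (θ • ξ)) = Real.cos (θ - θ') := by
  have h1 : ξ 0 ^ 2 + ξ 1 ^ 2 + ξ 2 ^ 2 = 1 := by
    rw [← vnorm_sq_three, hξ]; norm_num
  have h : ((rotVec (θ' • ξ))⁻¹ * rotVec (θ • ξ)).1
      = (1 + Real.sin θ' • hat ξ + (1 - Real.cos θ') • (hat ξ * hat ξ))ᵀ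
        * (1 + Real.sin θ • hat ξ + (1 - Real.cos θ) • (hat ξ * hat ξ)) := by
    change ((rotVec (θ' • ξ))⁻¹).1 * (rotVec (θ • ξ)).1 = _
    rw [SO3.coe_inv]
    change (rodrigues _)ᵀ * rodrigues _ = _
    rw [rodrigues_smul hξ, rodrigues_smul hξ]
  rw [cosAngle, h, Real.cos_sub]
  generalize Real.sin θ = s, Real.sin θ' = s', Real.cos θ = c, Real.cos θ' = c'
  obtain ⟨x, hx⟩ : ∃ x, x = ξ 0 := ⟨_, rfl⟩
  obtain ⟨y, hy⟩ : ∃ y, y = ξ 1 := ⟨_, rfl⟩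
  obtain ⟨z, hz⟩ : ∃ z, z = ξ 2 := ⟨_, rfl⟩
  have hz2 : z ^ 2 = 1 - x ^ 2 - y ^ 2 := by rw [hx, hy, hz]; linarith
  have hH : hat ξ = !![0, -z, y; z, 0, -x; -y, x, 0] := by rw [hat, hx, hy, hz]
  have hH2 : hat ξ * hat ξ
      = !![x ^ 2 - 1, x * y, x * z; x * y, y ^ 2 - 1, y * z; x * z, y * z, z ^ 2 - 1] := by
    rw [hH]
    ext i j
    fin_cases i <;> fin_cases j <;> simp [Matrix.mul_apply, Fin.sum_univ_three] <;>
      grind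
  rw [hH2, hH]
  simp [Matrix.trace, Matrix.mul_apply, Fin.sum_univ_three]
  grind

end axis

/-- A function that is Lipschitz in an angle of `[-π, π]` and takes the same values at the ends is
Lipschitz on the circle. -/
theorem vnorm_sub_le_of_cos_pos {X : Type*} {F : X → ℝ → Vec6} {C : ℝ} (hC : 0 ≤ C)
    {d : X → X → ℝ} (hd : ∀ p, d p p = 0)
    (hF : ∀ p p' θ θ', |θ| ≤ Real.pi → |θ'| ≤ Real.pi →
      vnorm (F p θ - F p' θ') ≤ C * (d p p' + |θ - θ'|))
    (hend : ∀ p, F p Real.pi = F p (-Real.pi)) (p p' : X) {θ θ' : ℝ} (hθ : |θ| ≤ Real.pi)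
    (hθ' : |θ'| ≤ Real.pi) (hcos : 0 < Real.cos (θ - θ')) :
    vnorm (F p θ - F p' θ') ≤ C * (d p p' + 2 * |Real.sin (θ - θ')|) := by
  have hπ := Real.pi_pos
  have hπ4 := Real.pi_le_four
  have hsin : ∀ x : ℝ, |x| ≤ Real.pi / 2 → |x| ≤ 2 * |Real.sin x| := by
    intro x hx
    have h := Real.mul_abs_le_abs_sin hx
    have h2 : 1 / 2 * |x| ≤ 2 / Real.pi * |x| := by
      refine mul_le_mul_of_nonneg_right ?_ (abs_nonneg _)
      rw [div_le_div_iff₀ two_pos hπ]; linarith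
    linarith
  have hmain : ∀ x : ℝ, |x| ≤ Real.pi / 2 → |Real.sin x| = |Real.sin (θ - θ')| →
      vnorm (F p θ - F p' θ') ≤ C * (d p p' + |x|) →
      vnorm (F p θ - F p' θ') ≤ C * (d p p' + 2 * |Real.sin (θ - θ')|) := by
    intro x hx hxs h
    refine h.trans (mul_le_mul_of_nonneg_left ?_ hC)
    have := hsin x hx
    rw [hxs] at this
    linarith
  have hpi : |Real.pi| ≤ Real.pi := (abs_of_pos hπ).le
  have hnpi : |-Real.pi| ≤ Real.pi := by rw [abs_neg]; exact hpi
  obtain ⟨a1, a2⟩ := abs_le.mp hθ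
  obtain ⟨b1, b2⟩ := abs_le.mp hθ'
  rcases le_or_gt |θ - θ'| (Real.pi / 2) with h | h
  · exact hmain _ h rfl (hF _ _ _ _ hθ hθ')
  -- A positive cosine excludes differences between `π / 2` and `3 π / 2`. The remaining pairs lie
  -- on either side of the cut at `±π`, and the path between them is led through the cut, where the
  -- two end values agree.
  have h32 : 3 * Real.pi / 2 < |θ - θ'| := by
    by_contra hcon
    rw [not_lt] at hcon
    have := Real.cos_nonpos_of_pi_div_two_le_of_le h.le (by linarith)
    rw [Real.cos_abs] at this
    linarith
  rcases lt_abs.mp h32 with h1 | h1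
  · refine hmain (θ - θ' - 2 * Real.pi) (abs_le.mpr ⟨by linarith, by linarith⟩)
      (by rw [Real.sin_sub_two_pi]) ?_
    have e1 := hF p p θ Real.pi hθ hpi
    have e2 := hF p p' (-Real.pi) θ' hnpi hθ'
    rw [← hend] at e2
    refine (vnorm_sub_le _ (F p Real.pi) _).trans ((add_le_add e1 e2).trans (le_of_eq ?_))
    rw [hd, abs_of_nonpos (by linarith : θ - Real.pi ≤ 0),
      abs_of_nonpos (by linarith : -Real.pi - θ' ≤ 0),
      abs_of_nonpos (by linarith : θ - θ' - 2 * Real.pi ≤ 0)]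
    ring
  · refine hmain (θ - θ' + 2 * Real.pi) (abs_le.mpr ⟨by linarith, by linarith⟩)
      (by rw [Real.sin_add_two_pi]) ?_
    have e1 := hF p p θ (-Real.pi) hθ hnpi
    have e2 := hF p p' Real.pi θ' hpi hθ'
    rw [← hend] at e1
    refine (vnorm_sub_le _ (F p Real.pi) _).trans ((add_le_add e1 e2).trans (le_of_eq ?_))
    rw [hd, abs_of_nonneg (by linarith : 0 ≤ θ - -Real.pi),
      abs_of_nonneg (by linarith : 0 ≤ Real.pi - θ'),
      abs_of_nonneg (by linarith : 0 ≤ θ - θ' + 2 * Real.pi)]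
    ring

theorem inv_mul_pos (gBar g : SE3) :
    (gBar⁻¹ * g).pos = (gBar.rot⁻¹).1 *ᵥ (g.pos - gBar.pos) := by
  change (gBar.rot⁻¹).1 *ᵥ g.pos + -((gBar.rot⁻¹).1 *ᵥ gBar.pos) = _
  rw [Matrix.mulVec_sub, sub_eq_add_neg]

/-- For a common axis the squared error norm is `‖p - p̄‖² + sin² (θ - θ')`. Since the relative
angle is below `π / 2`, the sine controls the distance of the angles on the circle. -/
theorem exists_isErrLipschitz {D : Set (Fin 3 → ℝ)} {ξ : Fin 3 → ℝ} (hξ : vnorm ξ = 1)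
    {V : SE3 → Vec6} {C : ℝ} (hC : 0 ≤ C)
    (hV : ∀ x ∈ poseDomain D, ∀ y ∈ poseDomain D,
      vnorm (V (poseOf x) - V (poseOf y)) ≤ C * vnorm (x - y)) :
    ∃ L : ℝ, 0 < L ∧ IsErrLipschitz D ξ V L := by
  -- The position difference and the sine are each at most the error norm, and the sine counts
  -- twice. The summand `1` ensures positivity.
  refine ⟨C * 3 + 1, by positivity, fun g gBar hg hgBar hax haxBar hangle => ?_⟩
  obtain ⟨θ, hθ, hR⟩ := hax.exists_abs_le_pi hξ
  obtain ⟨θ', hθ', hR'⟩ := haxBar.exists_abs_le_pi hξ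
  have hrot : (gBar⁻¹ * g).rot = (rotVec (θ' • ξ))⁻¹ * rotVec (θ • ξ) := by
    rw [← hR, ← hR']; rfl
  have hcosA : cosAngle (gBar⁻¹ * g).rot = Real.cos (θ - θ') := by
    rw [hrot, cosAngle_inv_mul_rotVec hξ]
  rw [cosAngle_pos_iff, hcosA] at hangle
  have hmem : ∀ p : D, ∀ φ : ℝ, |φ| ≤ Real.pi →
      (Sum.elim p.1 (φ • ξ) : Vec6) ∈ poseDomain D := by
    intro p φ hφ
    refine ⟨p.2, ?_⟩
    rw [Sum.elim_comp_inr, vnorm_smul, hξ, mul_one]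
    exact hφ
  have key := vnorm_sub_le_of_cos_pos (X := D) (F := fun p φ => V ⟨p.1, rotVec (φ • ξ)⟩) hC
    (d := fun p p' => vnorm (p.1 - p'.1)) (fun p => by rw [sub_self, vnorm_zero]) (by
      intro p p' φ φ' hφ hφ'
      refine (hV _ (hmem p φ hφ) _ (hmem p' φ' hφ')).trans (mul_le_mul_of_nonneg_left ?_ hC)
      have e : (Sum.elim p.1 (φ • ξ) : Vec6) - Sum.elim p'.1 (φ' • ξ)
          = Sum.elim (p.1 - p'.1) ((φ - φ') • ξ) := by
        rw [sub_smul]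
        ext i; rcases i with i | i <;> rfl
      have h0 := vnorm_nonneg (p.1 - p'.1)
      rw [e, ← sq_le_sq₀ (vnorm_nonneg _) (add_nonneg h0 (abs_nonneg _)),
        vnorm_sq_sumElim, vnorm_smul, hξ, mul_one]
      nlinarith [mul_nonneg h0 (abs_nonneg (φ - φ'))])
    (fun p => by
      rw [rotVec_smul_congr hξ (θ := Real.pi) (θ' := -Real.pi) (by simp) (by simp)])
    ⟨g.pos, hg⟩ ⟨gBar.pos, hgBar⟩ hθ hθ' hangle
  have hg' : (⟨g.pos, rotVec (θ • ξ)⟩ : SE3) = g := by rw [← hR]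
  have hgBar' : (⟨gBar.pos, rotVec (θ' • ξ)⟩ : SE3) = gBar := by rw [← hR']
  simp only [hg', hgBar'] at key
  have hsq := vnorm_errVec_sq (gBar⁻¹ * g)
  rw [hcosA, inv_mul_pos, vnorm_SO3_mulVec] at hsq
  have he0 := vnorm_nonneg (errVec (gBar⁻¹ * g))
  have hp0 := vnorm_nonneg (g.pos - gBar.pos)
  have hsc := Real.sin_sq_add_cos_sq (θ - θ')
  have hp : vnorm (g.pos - gBar.pos) ≤ vnorm (errVec (gBar⁻¹ * g)) := by
    rw [← sq_le_sq₀ hp0 he0]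
    nlinarith [sq_nonneg (Real.sin (θ - θ'))]
  have hs : |Real.sin (θ - θ')| ≤ vnorm (errVec (gBar⁻¹ * g)) := by
    rw [← sq_le_sq₀ (abs_nonneg _) he0, sq_abs]
    nlinarith
  calc _ ≤ _ := key
    _ ≤ C * (vnorm (errVec (gBar⁻¹ * g)) + 2 * vnorm (errVec (gBar⁻¹ * g))) := by gcongr
    _ ≤ _ := by linarith

/-! ### Descent along functions that are differentiable off the switching times -/

section descent

/-- The interval is split at one exceptional point at a time; continuity lets the pieces be chained.
-/
theorem le_of_deriv_nonpos_off_finite {f : ℝ → ℝ} {F : Set ℝ} (hF : F.Finite) :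
    ∀ {a b : ℝ}, a ≤ b → ContinuousOn f (Set.Icc a b) →
      (∀ t ∈ Set.Ioo a b, t ∉ F → ∃ d ≤ 0, HasDerivAt f d t) → f b ≤ f a := by
  induction F, hF using Set.Finite.induction_on with
  | empty =>
    intro a b hab hf h
    refine antitoneOn_of_deriv_nonpos (convex_Icc a b) hf ?_ ?_ (Set.left_mem_Icc.mpr hab)
      (Set.right_mem_Icc.mpr hab) hab
    · intro t ht
      rw [interior_Icc] at ht
      obtain ⟨d, -, hd⟩ := h t ht (Set.notMem_empty t)
      exact hd.differentiableAt.differentiableWithinAt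
    · intro t ht
      rw [interior_Icc] at ht
      obtain ⟨d, hd0, hd⟩ := h t ht (Set.notMem_empty t)
      rwa [hd.deriv]
  | @insert c F _ _ ih =>
    intro a b hab hf h
    by_cases hc : c ∈ Set.Ioo a b
    · have h1 : f b ≤ f c := by
        refine ih hc.2.le (hf.mono (Set.Icc_subset_Icc_left hc.1.le)) fun t ht htF => ?_
        exact h t ⟨hc.1.trans ht.1, ht.2⟩ (by
          rintro (rfl | h'); exacts [lt_irrefl _ ht.1, htF h'])
      have h2 : f c ≤ f a := by
        refine ih hc.1.le (hf.mono (Set.Icc_subset_Icc_right hc.2.le)) fun t ht htF => ?_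
        exact h t ⟨ht.1, ht.2.trans hc.2⟩ (by
          rintro (rfl | h'); exacts [lt_irrefl _ ht.2, htF h'])
      exact h1.trans h2
    · refine ih hab hf fun t ht htF => h t ht ?_
      rintro (rfl | h'); exacts [hc ht, htF h']

variable {S : ℝ → ℝ} {J : Set ℝ}

theorem le_sub_mul_of_deriv_le (hS : ContinuousOn S (Set.Ici 0))
    (hJ : ∀ T, (J ∩ Set.Icc 0 T).Finite) {η a b : ℝ} (ha : 0 ≤ a) (hab : a ≤ b)
    (h : ∀ t ∈ Set.Ioo a b, t ∉ J → ∃ d ≤ -η, HasDerivWithinAt S d (Set.Ici 0) t) :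
    S b ≤ S a - η * (b - a) := by
  have key : S b + η * b ≤ S a + η * a := by
    refine le_of_deriv_nonpos_off_finite (f := fun t => S t + η * t) (hJ b) hab ?_ ?_
    · exact (hS.mono fun t ht => ha.trans ht.1).add (by fun_prop)
    · intro t ht htJ
      have ht0 : 0 < t := ha.trans_lt ht.1
      obtain ⟨d, hd, hd'⟩ := h t ht fun hmem => htJ ⟨hmem, ht0.le, ht.2.le⟩
      refine ⟨d + η, by linarith, ?_⟩
      have h1 := hd'.hasDerivAt (Ici_mem_nhds ht0)
      simpa using h1.fun_add ((hasDerivAt_id t).const_mul η)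
  linarith

/-- After the last time `c` at which `S ≤ l`, the function stays above `l` and cannot increase, so
it never exceeds `S c`. -/
theorem le_of_deriv_nonpos_above (hS : ContinuousOn S (Set.Ici 0))
    (hJ : ∀ T, (J ∩ Set.Icc 0 T).Finite) {l t₀ : ℝ} (ht₀ : 0 ≤ t₀)
    (h : ∀ t, t₀ ≤ t → t ∉ J → l < S t → ∃ d ≤ 0, HasDerivWithinAt S d (Set.Ici 0) t)
    (h0 : S t₀ ≤ l) {t : ℝ} (ht : t₀ ≤ t) : S t ≤ l := by
  by_contra hcon
  rw [not_le] at hcon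
  have hcont : ContinuousOn S (Set.Icc t₀ t) := hS.mono fun τ hτ => ht₀.trans hτ.1
  obtain ⟨A, hA⟩ : ∃ A, A = Set.Icc t₀ t ∩ S ⁻¹' Set.Iic l := ⟨_, rfl⟩
  have hAc : IsCompact A := by
    rw [hA]
    exact isCompact_Icc.of_isClosed_subset (hcont.preimage_isClosed_of_isClosed isClosed_Icc
      isClosed_Iic) Set.inter_subset_left
  have hAn : A.Nonempty := ⟨t₀, hA ▸ ⟨Set.left_mem_Icc.mpr ht, h0⟩⟩
  have hmem := hAc.sSup_mem hAn
  have hub : ∀ τ ∈ A, τ ≤ sSup A := fun τ hτ => le_csSup hAc.bddAbove hτ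
  generalize sSup A = c at hmem hub
  rw [hA] at hmem
  have hdec := le_sub_mul_of_deriv_le (η := 0) hS hJ (ht₀.trans hmem.1.1) hmem.1.2
    fun τ hτ hτJ => by
      have hτ0 : t₀ ≤ τ := hmem.1.1.trans hτ.1.le
      have hSτ : l < S τ := by
        by_contra hle
        rw [not_lt] at hle
        exact absurd (hub τ (hA ▸ ⟨⟨hτ0, hτ.2.le⟩, hle⟩)) (not_le.mpr hτ.1)
      simpa using h τ hτ0 hτJ hSτ
  have : S c ≤ l := hmem.2
  linarith

/-- Staying above `l` during time `T` would cost `η T` and bring `S` down to `l`. Once reached, the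
sublevel set is not left. -/
theorem le_after_of_deriv_le_above (hS : ContinuousOn S (Set.Ici 0))
    (hJ : ∀ T, (J ∩ Set.Icc 0 T).Finite) {l η A T t₀ : ℝ} (ht₀ : 0 ≤ t₀) (hη : 0 < η)
    (hT : 0 ≤ T) (hAT : A - η * T ≤ l)
    (h : ∀ t, t₀ ≤ t → t ∉ J → l < S t → ∃ d ≤ -η, HasDerivWithinAt S d (Set.Ici 0) t)
    (h0 : S t₀ ≤ A) {t : ℝ} (ht : t₀ + T ≤ t) : S t ≤ l := by
  have hex : ∃ τ ∈ Set.Icc t₀ (t₀ + T), S τ ≤ l := by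
    by_contra hcon
    push Not at hcon
    have h1 := hcon (t₀ + T) (Set.right_mem_Icc.mpr (by linarith))
    have h2 := le_sub_mul_of_deriv_le hS hJ ht₀ (by linarith : t₀ ≤ t₀ + T)
      fun τ hτ hτJ => h τ hτ.1.le hτJ (hcon τ (Set.Ioo_subset_Icc_self hτ))
    rw [add_sub_cancel_left] at h2
    linarith
  obtain ⟨τ, hτ, hSτ⟩ := hex
  refine le_of_deriv_nonpos_above hS hJ (ht₀.trans hτ.1) (fun r hr hrJ hSr => ?_) hSτ
    (hτ.2.trans ht)
  obtain ⟨d, hd, hd'⟩ := h r (hτ.1.trans hr) hrJ hSr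
  exact ⟨d, by linarith, hd'⟩

end descent

/-! ### Continuity of the storage function along the closed loop -/

theorem continuousOn_toMat_iff {g : ℝ → SE3} {A : Set ℝ} :
    ContinuousOn (fun t => (g t).toMat) A ↔
      (∀ i, ContinuousOn (fun t => (g t).pos i) A) ∧
        ∀ i j, ContinuousOn (fun t => (g t).rot.1 i j) A := by
  constructor
  · intro h
    have h' : ∀ i j, ContinuousOn (fun t => (g t).toMat i j) A := fun i j =>
      (continuous_apply_apply i j).comp_continuousOn h
    exact ⟨fun i => h' (Sum.inl i) (Sum.inr ()), fun i j => h' (Sum.inl i) (Sum.inl j)⟩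
  · rintro ⟨h1, h2⟩
    refine continuousOn_pi.mpr fun i => continuousOn_pi.mpr fun j => ?_
    rcases i with i | i <;> rcases j with j | j
    · exact h2 i j
    · exact h1 i
    · exact continuousOn_const
    · exact continuousOn_const

theorem continuousOn_toMat_mul {g h : ℝ → SE3} {A : Set ℝ}
    (hg : ContinuousOn (fun t => (g t).toMat) A) (hh : ContinuousOn (fun t => (h t).toMat) A) :
    ContinuousOn (fun t => (g t * h t).toMat) A := by
  simp only [SE3.toMat_mul]
  refine continuousOn_pi.mpr fun i => continuousOn_pi.mpr fun j => ?_
  simp only [Matrix.mul_apply]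
  exact continuousOn_finsetSum _ fun k _ =>
    ((continuous_apply_apply i k).comp_continuousOn hg).mul
      ((continuous_apply_apply k j).comp_continuousOn hh)

theorem continuousOn_toMat_inv {g : ℝ → SE3} {A : Set ℝ}
    (hg : ContinuousOn (fun t => (g t).toMat) A) :
    ContinuousOn (fun t => ((g t)⁻¹).toMat) A := by
  rw [continuousOn_toMat_iff] at hg ⊢
  obtain ⟨hp, hr⟩ := hg
  constructor
  · intro i
    have : (fun t => ((g t)⁻¹).pos i) = fun t => -∑ k, (g t).rot.1 k i * (g t).pos k := by
      ext τ
      change (-(((g τ).rot⁻¹).1 *ᵥ (g τ).pos)) i = _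
      rw [SO3.coe_inv]; rfl
    rw [this]
    exact (continuousOn_finsetSum _ fun k _ => (hr k i).mul (hp k)).neg
  · intro i j
    have : (fun t => ((g t)⁻¹).rot.1 i j) = fun t => (g t).rot.1 j i := by
      ext τ
      change ((g τ).rot⁻¹).1 i j = _
      rw [SO3.coe_inv]; rfl
    rw [this]
    exact hr j i

theorem continuousOn_poseStorage {g : ℝ → SE3} {A : Set ℝ}
    (hg : ContinuousOn (fun t => (g t).toMat) A) :
    ContinuousOn (fun t => poseStorage (g t)) A := by
  rw [continuousOn_toMat_iff] at hg
  obtain ⟨hp, hr⟩ := hg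
  have e : (fun t => poseStorage (g t)) = fun t =>
      1 / 2 * (∑ i, (g t).pos i ^ 2 + (3 - ∑ i, (g t).rot.1 i i)) := by
    ext τ
    rw [poseStorage, vnorm_sq_eq_sum, Matrix.trace_sub, Matrix.trace_one]
    simp [Matrix.trace]
  rw [e]
  exact continuousOn_const.mul ((continuousOn_finsetSum _ fun i _ => (hp i).pow 2).add
    (continuousOn_const.sub (continuousOn_finsetSum _ fun i _ => hr i i)))

theorem ClosedLoop.continuousOn_storage {Ψ : Type*} {V : Ψ → SE3 → Vec6} {μ : Ψ → Vec6 → Vec6}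
    {Kc Ke : Matrix I6 I6 ℝ} {gd : SE3} {s : ℝ → Ψ} {σ : Signals}
    (h : ClosedLoop V μ Kc Ke gd s σ) :
    ContinuousOn (fun τ => storage (σ.gce gd τ) (σ.gee τ)) (Set.Ici 0) := by
  simp only [storage_eq_add]
  exact (continuousOn_poseStorage (continuousOn_toMat_mul continuousOn_const h.cont_co)).add
    (continuousOn_poseStorage (continuousOn_toMat_mul (continuousOn_toMat_inv h.cont_co)
      (continuousOn_toMat_mul (continuousOn_toMat_inv h.cont_wc) h.cont_wo)))

/-! ### Decrease of the storage function -/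

theorem SE3.toMat_injective : Function.Injective SE3.toMat := by
  intro g h hgh
  have hp : g.pos = h.pos := by
    ext i; exact congrFun (congrFun hgh (Sum.inl i)) (Sum.inr ())
  have hr : g.rot = h.rot := by
    apply Subtype.ext
    ext i j; exact congrFun (congrFun hgh (Sum.inl i)) (Sum.inl j)
  cases g; cases h
  simp only at hp hr
  rw [hp, hr]

/-- Identifies the estimation error with the relative pose of estimated and true target, the form
required by `IsErrLipschitz`. -/
theorem SE3.inv_mul_eq (a b c : SE3) : b⁻¹ * (a⁻¹ * c) = (a * b)⁻¹ * c := by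
  apply SE3.toMat_injective
  have h : (b⁻¹).toMat * (a⁻¹).toMat = ((a * b)⁻¹).toMat := by
    refine left_inv_eq_right_inv (a := (a * b).toMat) ?_ (SE3.toMat_inv _)
    rw [SE3.toMat_mul, Matrix.mul_assoc, ← Matrix.mul_assoc (a⁻¹).toMat, SE3.inv_toMat_mul,
      Matrix.one_mul, SE3.inv_toMat_mul]
  simp only [SE3.toMat_mul]
  rw [← Matrix.mul_assoc, h]

theorem mem_poseDomain {D : Set (Fin 3 → ℝ)} {g : SE3} {x : Vec6} (h : IsVectorForm g x)
    (hg : g.pos ∈ D) : x ∈ poseDomain D := by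
  refine ⟨?_, h.2⟩
  rw [← h.1] at hg
  exact hg

theorem exists_deriv_storage_le {Ψ : Type*} {V : Ψ → SE3 → Vec6} {μ : Ψ → Vec6 → Vec6}
    {Kc Ke : Matrix I6 I6 ℝ} {gd : SE3} {s : ℝ → Ψ} {σ : Signals} {D : Set (Fin 3 → ℝ)}
    {ξ : Fin 3 → ℝ} (hKc : Kc.IsSymm) (hKe : Ke.IsSymm) (hlam : 0 < lamK Kc Ke)
    (h : ClosedLoop V μ Kc Ke gd s σ) {t : ℝ} (ht : 0 ≤ t) (hs : t ∉ switchTimes s)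
    (hadm : Admissible D ξ gd σ t) {L Δ : ℝ} (hL : IsErrLipschitz D ξ (V (s t)) L)
    (hΔ : vnorm (V (s t) (poseOf (σ.xBar t)) - μ (s t) (σ.xBar t)) ≤ Δ) :
    ∃ d ≤ -(lamK Kc Ke * vnorm (errVec (σ.gce gd t)) ^ 2)
        - (lamK Kc Ke - L) * vnorm (errVec (σ.gee t)) ^ 2 + Δ * vnorm (errVec (σ.gee t)),
      HasDerivWithinAt (fun τ => storage (σ.gce gd τ) (σ.gee τ)) d (Set.Ici 0) t := by
  refine ⟨_, ?_, hasDerivWithinAt_storage h ht hs⟩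
  have hgee : σ.gee t = (σ.gwoBar t)⁻¹ * σ.gwo t := SE3.inv_mul_eq _ _ _
  have h1 := lamK_mul_le hKc hKe hlam hadm.angle_ce (σ.err gd t)
  rw [← vnorm_sq, σ.vnorm_err_sq] at h1
  have hang := hadm.angle_ee
  rw [hgee] at hang
  have h2 := hL _ _ hadm.pos_mem hadm.posBar_mem hadm.axis hadm.axisBar hang
  rw [← hgee] at h2
  rw [(h.vectorForm t ht).1] at hΔ
  have h3 := dotProduct_le_vnorm (errVec (σ.gee t))
    (adjointRot (σ.gee t).rot *ᵥ (V (s t) (σ.gwo t) - μ (s t) (σ.xBar t)))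
  rw [vnorm_adjointRot_mulVec] at h3
  have h4 := vnorm_sub_le (V (s t) (σ.gwo t)) (V (s t) (σ.gwoBar t)) (μ (s t) (σ.xBar t))
  have h5 := mul_le_mul_of_nonneg_left (h4.trans (add_le_add h2 hΔ))
    (vnorm_nonneg (errVec (σ.gee t)))
  linarith

theorem ellipseFun_identity {lam lam' c : ℝ} (hlam : 0 < lam) (hlam' : 0 ≤ lam') (gce gee : SE3) :
    -(lam * vnorm (errVec gce) ^ 2) - lam' * vnorm (errVec gee) ^ 2
        + 2 * lam' * c * vnorm (errVec gee)
      = -(lam * (ellipseFun lam lam' c gce gee * (ellipseFun lam lam' c gce gee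
        + 2 * (Real.sqrt (lam' / lam) * c)))) := by
  have h0 : 0 ≤ lam' / lam := div_nonneg hlam' hlam.le
  have h1 := Real.sq_sqrt h0
  have h2 := Real.sq_sqrt (x := vnorm (errVec gce) ^ 2
    + lam' / lam * (vnorm (errVec gee) - c) ^ 2) (by positivity)
  have h3 : lam * (lam' / lam) = lam' := by field_simp
  rw [ellipseFun]
  generalize Real.sqrt (lam' / lam) = r at *
  generalize Real.sqrt _ = w at *
  generalize lam' / lam = q at *
  rw [← h3]
  linear_combination (-lam) * h1 * c ^ 2 + lam * h2

theorem GPModel.errBound_nonneg (G : GPModel) (D : Set (Fin 3 → ℝ)) (B : Vec6) (δ : ℝ) (x : Vec6) :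
    0 ≤ G.errBound D B δ x := vnorm_nonneg _

/-- Outside the ellipse, the decrease of the storage function is quadratic in the distance
function `E`. -/
theorem exists_deriv_storage_le_profileE {Ψ : Type*} {V : Ψ → SE3 → Vec6} {μ : Ψ → Vec6 → Vec6}
    {Kc Ke : Matrix I6 I6 ℝ} {gd : SE3} {s : ℝ → Ψ} {σ : Signals} {D : Set (Fin 3 → ℝ)}
    {ξ : Fin 3 → ℝ} (hKc : Kc.IsSymm) (hKe : Ke.IsSymm)
    (h : ClosedLoop V μ Kc Ke gd s σ) {t : ℝ} (ht : 0 ≤ t) (hs : t ∉ switchTimes s)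
    (hadm : Admissible D ξ gd σ t) {L : ℝ} (hL0 : 0 ≤ L) (hL : IsErrLipschitz D ξ (V (s t)) L)
    (hlam : 0 < lamK Kc Ke - L) {G : GPModel} {B : Vec6} {δ : ℝ}
    (hΔ : vnorm (V (s t) (poseOf (σ.xBar t)) - μ (s t) (σ.xBar t))
      ≤ G.errBound D B δ (σ.xBar t)) {e : ℝ} (he0 : 0 ≤ e)
    (he : e ≤ profileE G D B δ (lamK Kc Ke) L (σ.gce gd t) (σ.gee t) (σ.xBar t)) :
    ∃ d ≤ -(lamK Kc Ke * e ^ 2),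
      HasDerivWithinAt (fun τ => storage (σ.gce gd τ) (σ.gee τ)) d (Set.Ici 0) t := by
  have hlam0 : 0 < lamK Kc Ke := by linarith
  obtain ⟨d, hd, hd'⟩ := exists_deriv_storage_le hKc hKe hlam0 h ht hs hadm hL hΔ
  refine ⟨d, hd.trans ?_, hd'⟩
  have hid := ellipseFun_identity (c := 1 / (2 * (lamK Kc Ke - L)) * G.errBound D B δ (σ.xBar t))
    hlam0 hlam.le (σ.gce gd t) (σ.gee t)
  -- The factor `1 / (2 (λ_K - L))` in the size of the ellipse is the one that matches the linear
  -- term when the square is completed.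
  have hc : 2 * (lamK Kc Ke - L) * (1 / (2 * (lamK Kc Ke - L)) * G.errBound D B δ (σ.xBar t))
      = G.errBound D B δ (σ.xBar t) := by field_simp
  rw [hc] at hid
  rw [hid]
  refine neg_le_neg (mul_le_mul_of_nonneg_left ?_ hlam0.le)
  have hc0 : 0 ≤ Real.sqrt ((lamK Kc Ke - L) / lamK Kc Ke)
      * (1 / (2 * (lamK Kc Ke - L)) * G.errBound D B δ (σ.xBar t)) :=
    mul_nonneg (Real.sqrt_nonneg _) (mul_nonneg (by positivity) (G.errBound_nonneg D B δ _))
  rw [profileE] at he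
  nlinarith

/-! ### A positive distance to the ellipse on sublevel sets of the storage function -/

section compactness

theorem isCompact_specialOrthogonalGroup :
    IsCompact (Matrix.specialOrthogonalGroup (Fin 3) ℝ : Set (Matrix (Fin 3) (Fin 3) ℝ)) := by
  have hbox : IsCompact (Set.univ.pi fun _ : Fin 3 => Set.univ.pi fun _ : Fin 3 =>
      Set.Icc (-1 : ℝ) 1) := isCompact_univ_pi fun _ => isCompact_univ_pi fun _ => isCompact_Icc
  refine hbox.of_isClosed_subset ?_ ?_
  · have : (Matrix.specialOrthogonalGroup (Fin 3) ℝ : Set (Matrix (Fin 3) (Fin 3) ℝ))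
        = {A | A * Aᵀ = 1} ∩ {A | A.det = 1} := by
      ext A
      rw [SetLike.mem_coe, Matrix.mem_specialOrthogonalGroup_iff, Matrix.mem_orthogonalGroup_iff]
      rfl
    rw [this]
    refine (isClosed_eq ?_ continuous_const).inter (isClosed_eq ?_ continuous_const)
    · exact continuous_id.matrix_mul continuous_id.matrix_transpose
    · exact continuous_id.matrix_det
  · intro A hA i _ j _
    have h := congrFun (congrFun (SO3.mul_transpose ⟨A, hA⟩) i) i
    simp only [Matrix.one_apply_eq] at h
    have h1 : A i j * A i j ≤ 1 := by
      rw [← h]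
      exact Finset.single_le_sum (f := fun k => A i k * A i k)
        (fun k _ => mul_self_nonneg _) (Finset.mem_univ j)
    exact abs_le.mp (abs_le_one_iff_mul_self_le_one.mpr h1)

instance : CompactSpace SO3 := isCompact_iff_compactSpace.mp isCompact_specialOrthogonalGroup

theorem isCompact_vnorm_le (r : ℝ) : IsCompact {v : Fin 3 → ℝ | vnorm v ≤ r} := by
  refine (isCompact_univ_pi fun _ : Fin 3 => isCompact_Icc (a := -r) (b := r)).of_isClosed_subset
    (isClosed_le continuous_vnorm continuous_const) fun v hv i _ => ?_
  exact abs_le.mp ((abs_le_vnorm v i).trans hv)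

theorem isCompact_poseDomain {D : Set (Fin 3 → ℝ)} (hD : IsCompact D) :
    IsCompact (poseDomain D) := by
  have himg : poseDomain D = (fun q : (Fin 3 → ℝ) × (Fin 3 → ℝ) => (Sum.elim q.1 q.2 : Vec6)) ''
      (D ×ˢ {v | vnorm v ≤ Real.pi}) := by
    ext x
    constructor
    · intro hx
      exact ⟨(x ∘ Sum.inl, x ∘ Sum.inr), hx, Sum.elim_comp_inl_inr x⟩
    · rintro ⟨q, hq, rfl⟩
      exact hq
  rw [himg]
  refine (hD.prod (isCompact_vnorm_le _)).image (continuous_pi fun i => ?_)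
  rcases i with i | i
  · exact (continuous_apply i).comp continuous_fst
  · exact (continuous_apply i).comp continuous_snd

theorem continuous_SO3_apply (i j : Fin 3) : Continuous fun R : SO3 => R.1 i j :=
  (continuous_apply_apply i j).comp continuous_subtype_val

theorem continuous_cosAngle : Continuous cosAngle := by
  unfold cosAngle Matrix.trace
  exact ((continuous_finsetSum _ fun i _ => continuous_SO3_apply i i).sub
    continuous_const).div_const _

theorem continuous_vnorm_errVec :
    Continuous fun q : (Fin 3 → ℝ) × SO3 => vnorm (errVec ⟨q.1, q.2⟩) := by
  have h : (fun q : (Fin 3 → ℝ) × SO3 => vnorm (errVec ⟨q.1, q.2⟩))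
      = fun q => Real.sqrt (vnorm q.1 ^ 2 + (1 - cosAngle q.2 ^ 2)) := by
    ext q
    rw [← Real.sqrt_sq (vnorm_nonneg (errVec _)), vnorm_errVec_sq]
  rw [h]
  exact Real.continuous_sqrt.comp (((continuous_vnorm.comp continuous_fst).pow 2).add
    (continuous_const.sub ((continuous_cosAngle.comp continuous_snd).pow 2)))

/-- `E` is continuous and positive on the set cut out by `l ≤ S ≤ A`, so its minimum there is
positive. Compactness requires the closed angle condition `≤ π / 2` and lets `x` range over the
whole domain. -/
theorem exists_pos_le_profileE {D : Set (Fin 3 → ℝ)} (hD : IsCompact D) (G : GPModel) (B : Vec6)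
    (δ lam L l A : ℝ)
    (h : ∀ gce gee : SE3, rotAngle gce.rot ≤ Real.pi / 2 → rotAngle gee.rot ≤ Real.pi / 2 →
      ∀ x ∈ poseDomain D, profileE G D B δ lam L gce gee x ≤ 0 → storage gce gee < l) :
    ∃ e : ℝ, 0 < e ∧ ∀ gce gee : SE3, rotAngle gce.rot ≤ Real.pi / 2 →
      rotAngle gee.rot ≤ Real.pi / 2 → ∀ x ∈ poseDomain D,
        l ≤ storage gce gee → storage gce gee ≤ A → e ≤ profileE G D B δ lam L gce gee x := by
  obtain ⟨F, hF⟩ : ∃ F : ((Fin 3 → ℝ) × SO3) × ((Fin 3 → ℝ) × SO3) × Vec6 → ℝ,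
      F = fun q => profileE G D B δ lam L ⟨q.1.1, q.1.2⟩ ⟨q.2.1.1, q.2.1.2⟩ q.2.2 := ⟨_, rfl⟩
  obtain ⟨S, hS⟩ : ∃ S : ((Fin 3 → ℝ) × SO3) × ((Fin 3 → ℝ) × SO3) × Vec6 → ℝ,
      S = fun q => storage ⟨q.1.1, q.1.2⟩ ⟨q.2.1.1, q.2.1.2⟩ := ⟨_, rfl⟩
  have hFc : Continuous F := by
    have h1 : Continuous fun q : ((Fin 3 → ℝ) × SO3) × ((Fin 3 → ℝ) × SO3) × Vec6 =>
        vnorm (errVec ⟨q.1.1, q.1.2⟩) := continuous_vnorm_errVec.comp continuous_fst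
    have h2 : Continuous fun q : ((Fin 3 → ℝ) × SO3) × ((Fin 3 → ℝ) × SO3) × Vec6 =>
        vnorm (errVec ⟨q.2.1.1, q.2.1.2⟩) :=
      continuous_vnorm_errVec.comp (continuous_fst.comp continuous_snd)
    have h3 : Continuous fun q : ((Fin 3 → ℝ) × SO3) × ((Fin 3 → ℝ) × SO3) × Vec6 =>
        1 / (2 * (lam - L)) * G.errBound D B δ q.2.2 :=
      continuous_const.mul ((G.continuous_errBound δ).comp (continuous_snd.comp continuous_snd))
    rw [hF]
    unfold profileE ellipseFun
    exact (Real.continuous_sqrt.comp ((h1.pow 2).add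
      (continuous_const.mul ((h2.sub h3).pow 2)))).sub (continuous_const.mul h3)
  have hSc : Continuous S := by
    have h1 : ∀ {X : Type} [TopologicalSpace X] {p : X → Fin 3 → ℝ} {R : X → SO3}, Continuous p →
        Continuous R → Continuous fun q => vnorm (p q) ^ 2 + 2 * (1 - cosAngle (R q)) :=
      fun hp hR => ((continuous_vnorm.comp hp).pow 2).add
        (continuous_const.mul (continuous_const.sub (continuous_cosAngle.comp hR)))
    rw [hS]
    simp only [storage_eq]
    exact continuous_const.mul ((h1 (by fun_prop) (by fun_prop)).add
      (h1 (by fun_prop) (by fun_prop)))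
  obtain ⟨K, hK⟩ : ∃ K : Set (((Fin 3 → ℝ) × SO3) × ((Fin 3 → ℝ) × SO3) × Vec6),
      K = (({v | vnorm v ≤ Real.sqrt (2 * A)} ×ˢ Set.univ) ×ˢ
        (({v | vnorm v ≤ Real.sqrt (2 * A)} ×ˢ Set.univ) ×ˢ poseDomain D)) ∩
        ((({q | 0 ≤ cosAngle q.1.2} ∩ {q | 0 ≤ cosAngle q.2.1.2}) ∩ {q | l ≤ S q})) := ⟨_, rfl⟩
  have hKc : IsCompact K := by
    rw [hK]
    refine IsCompact.inter_right ?_ ((IsClosed.inter ?_ ?_).inter ?_)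
    · exact ((isCompact_vnorm_le _).prod isCompact_univ).prod
        (((isCompact_vnorm_le _).prod isCompact_univ).prod (isCompact_poseDomain hD))
    · exact isClosed_le continuous_const (continuous_cosAngle.comp (by fun_prop))
    · exact isClosed_le continuous_const (continuous_cosAngle.comp (by fun_prop))
    · exact isClosed_le continuous_const hSc
  have hmem : ∀ gce gee : SE3, rotAngle gce.rot ≤ Real.pi / 2 → rotAngle gee.rot ≤ Real.pi / 2 →
      ∀ x ∈ poseDomain D, l ≤ storage gce gee → storage gce gee ≤ A →
        ((gce.pos, gce.rot), (gee.pos, gee.rot), x) ∈ K := by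
    intro gce gee hc he x hx hl hA
    have hb := hA
    rw [storage_eq] at hb
    have b1 := cosAngle_le_one gce.rot
    have b2 := cosAngle_le_one gee.rot
    rw [hK, hS]
    refine ⟨⟨⟨Real.le_sqrt_of_sq_le ?_, trivial⟩, ⟨Real.le_sqrt_of_sq_le ?_, trivial⟩, hx⟩,
      ⟨cosAngle_nonneg_iff.mp hc, cosAngle_nonneg_iff.mp he⟩, hl⟩
    · nlinarith [sq_nonneg (vnorm gee.pos)]
    · nlinarith [sq_nonneg (vnorm gce.pos)]
  rcases K.eq_empty_or_nonempty with hemp | hne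
  · refine ⟨1, one_pos, fun gce gee hc he x hx hl hA => ?_⟩
    have := hmem gce gee hc he x hx hl hA
    rw [hemp] at this
    exact this.elim
  · obtain ⟨q, hq, hmin⟩ := hKc.exists_isMinOn hne hFc.continuousOn
    refine ⟨F q, ?_, fun gce gee hc he x hx hl hA => ?_⟩
    · by_contra hle
      rw [not_lt] at hle
      rw [hK] at hq
      rw [hF] at hle
      have h1 := h ⟨q.1.1, q.1.2⟩ ⟨q.2.1.1, q.2.1.2⟩ (cosAngle_nonneg_iff.mpr hq.2.1.1)
        (cosAngle_nonneg_iff.mpr hq.2.1.2) q.2.2 hq.1.2.2 hle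
      have h2 : l ≤ S q := hq.2.2
      rw [hS] at h2
      exact absurd h1 (not_lt.mpr h2)
    · have := hmin (hmem gce gee hc he x hx hl hA)
      rw [hF] at this ⊢
      exact this

end compactness

/-! ### Convergence of closed-loop motions -/

section convergence

variable {Ψ : Type*} {V : Ψ → SE3 → Vec6} {μ : Ψ → Vec6 → Vec6} {Kc Ke : Matrix I6 I6 ℝ} {gd : SE3}
  {D : Set (Fin 3 → ℝ)} {ξ : Fin 3 → ℝ} {L : Ψ → ℝ}

theorem Admissible.storage_le {σ : Signals} {t a : ℝ} (h : Admissible D ξ gd σ t)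
    (ha : vnorm (σ.err gd t) ≤ a) : storage (σ.gce gd t) (σ.gee t) ≤ a ^ 2 := by
  refine (storage_le_err_sq (cosAngle_pos_iff.mp h.angle_ce).le
    (cosAngle_pos_iff.mp h.angle_ee).le).trans ?_
  rw [← σ.vnorm_err_sq]
  exact pow_le_pow_left₀ (vnorm_nonneg _) ha 2

theorem exists_pos_le_of_finite {ι : Type*} [Finite ι] (f : ι → ℝ) (hf : ∀ i, 0 < f i) :
    ∃ c : ℝ, 0 < c ∧ ∀ i, c ≤ f i := by
  cases isEmpty_or_nonempty ι
  · exact ⟨1, one_pos, fun i => isEmptyElim i⟩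
  · obtain ⟨i, hi⟩ := Finite.exists_min f
    exact ⟨f i, hf i, hi⟩

theorem uniformlyUltimatelyBounded_of_bound [Finite Ψ] (hKc : Kc.IsSymm) (hKe : Ke.IsSymm)
    (hL0 : ∀ ψ, 0 ≤ L ψ) (hL : ∀ ψ, IsErrLipschitz D ξ (V ψ) (L ψ))
    (hlam : ∀ ψ, 0 < lamK Kc Ke - L ψ) {C : ℝ}
    (hC : ∀ ψ, ∀ x ∈ poseDomain D, vnorm (V ψ (poseOf x) - μ ψ x) ≤ C) :
    UniformlyUltimatelyBounded gd (IsRun D ξ V μ Kc Ke gd Set.univ) := by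
  obtain ⟨κ, hκ, hκL⟩ := exists_pos_le_of_finite _ hlam
  -- By Young's inequality `C q ≤ κ q² / 2 + C² / (2 κ)`, so `S' ≤ -κ / 2` as soon as `p² + q² ≥ C²
  -- / κ² + 1`; this holds when `S > l`.
  obtain ⟨l, hl⟩ : ∃ l, l = C ^ 2 / κ ^ 2 + 1 := ⟨_, rfl⟩
  have hl0 : 0 < l := by rw [hl]; positivity
  refine ⟨Real.sqrt (2 * l), Real.sqrt_pos.mpr (by positivity), fun a ha =>
    ⟨a ^ 2 / (κ / 2), by positivity, fun s σ hrun t₀ ht₀ ha₀ t ht => ?_⟩⟩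
  obtain ⟨hcl, hadm⟩ := hrun
  have hS : storage (σ.gce gd t) (σ.gee t) ≤ l := by
    have ht₀' := (hadm t₀ ht₀).2.storage_le ha₀
    refine le_after_of_deriv_le_above (S := fun τ => storage (σ.gce gd τ) (σ.gee τ))
      hcl.continuousOn_storage hcl.switching (η := κ / 2) (A := a ^ 2) (T := a ^ 2 / (κ / 2)) ht₀
      (by positivity) (by positivity) ?_ ?_ ht₀' ht
    · rw [mul_div_cancel₀ _ (by positivity), sub_self]; exact hl0.le
    · intro τ hτ hτs hlτ
      have hτ0 := ht₀.trans hτ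
      obtain ⟨-, hadmτ⟩ := hadm τ hτ0
      have hx := mem_poseDomain (hcl.vectorForm τ hτ0) hadmτ.posBar_mem
      have hlam0 : 0 < lamK Kc Ke := by linarith [hlam (s τ), hL0 (s τ)]
      obtain ⟨d, hd, hd'⟩ := exists_deriv_storage_le hKc hKe hlam0 hcl hτ0 hτs hadmτ (hL (s τ))
        (hC (s τ) _ hx)
      refine ⟨d, hd.trans ?_, hd'⟩
      have h1 := storage_le_err_sq (cosAngle_pos_iff.mp hadmτ.angle_ce).le
        (cosAngle_pos_iff.mp hadmτ.angle_ee).le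
      have h2 : κ ≤ lamK Kc Ke := by linarith [hκL (s τ), hL0 (s τ)]
      have h3 := hκL (s τ)
      generalize storage (σ.gce gd τ) (σ.gee τ) = S at *
      generalize vnorm (errVec (σ.gce gd τ)) = p at *
      generalize vnorm (errVec (σ.gee τ)) = q at *
      have h4 := mul_le_mul_of_nonneg_right h2 (sq_nonneg p)
      have h5 := mul_le_mul_of_nonneg_right h3 (sq_nonneg q)
      have h6 : C * q ≤ κ / 2 * q ^ 2 + κ / 2 * (C ^ 2 / κ ^ 2) := by
        have : κ / 2 * q ^ 2 + κ / 2 * (C ^ 2 / κ ^ 2) - C * q = κ / 2 * (q - C / κ) ^ 2 := by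
          field_simp; ring
        nlinarith [sq_nonneg (q - C / κ)]
      have h7 : C ^ 2 / κ ^ 2 + 1 ≤ p ^ 2 + q ^ 2 := by linarith
      have h8 := mul_le_mul_of_nonneg_left h7 (by positivity : 0 ≤ κ / 2)
      nlinarith [mul_nonneg hκ.le (sq_nonneg p)]
  refine Real.le_sqrt_of_sq_le ?_
  rw [σ.vnorm_err_sq]
  exact (err_sq_le_two_mul_storage _ _).trans (by linarith)

variable {Φ : Set Ψ} {G : Ψ → GPModel} {B : Ψ → Vec6} {δ : ℝ}

/-- Every neighbourhood of the ellipses is reached within a uniform time. -/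
theorem exists_time_profileE_le (hKc : Kc.IsSymm) (hKe : Ke.IsSymm) (hlamK : 0 < lamK Kc Ke)
    (hL0 : ∀ ψ, 0 ≤ L ψ) (hL : ∀ ψ, IsErrLipschitz D ξ (V ψ) (L ψ))
    (hlam : ∀ ψ, 0 < lamK Kc Ke - L ψ)
    (hΔ : ∀ ψ ∈ Φ, ∀ x ∈ poseDomain D,
      vnorm (V ψ (poseOf x) - μ ψ x) ≤ (G ψ).errBound D (B ψ) δ x)
    {ε : ℝ} (hε : 0 < ε) (a : ℝ) :
    ∃ T : ℝ, 0 ≤ T ∧ ∀ (s : ℝ → Ψ) (σ : Signals), IsRun D ξ V μ Kc Ke gd Φ s σ →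
      ∀ t₀, 0 ≤ t₀ → vnorm (σ.err gd t₀) ≤ a → ∃ t ∈ Set.Icc t₀ (t₀ + T),
        profileE (G (s t)) D (B (s t)) δ (lamK Kc Ke) (L (s t))
          (σ.gce gd t) (σ.gee t) (σ.xBar t) ≤ ε := by
  have hη : 0 < lamK Kc Ke * ε ^ 2 := by positivity
  -- Initially `S ≤ a²`. Decreasing at rate `λ_K ε²` for this long would make `S` negative.
  refine ⟨(a ^ 2 + 1) / (lamK Kc Ke * ε ^ 2), by positivity, fun s σ hrun t₀ ht₀ ha₀ => ?_⟩
  obtain ⟨hcl, hadm⟩ := hrun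
  by_contra hcon
  push Not at hcon
  have ht₀' := (hadm t₀ ht₀).2.storage_le ha₀
  have hT : 0 ≤ (a ^ 2 + 1) / (lamK Kc Ke * ε ^ 2) := by positivity
  have hdec := le_sub_mul_of_deriv_le (S := fun τ => storage (σ.gce gd τ) (σ.gee τ))
    hcl.continuousOn_storage hcl.switching ht₀ (le_add_of_nonneg_right hT)
    (η := lamK Kc Ke * ε ^ 2) fun τ hτ hτs => by
      have hτ0 := ht₀.trans hτ.1.le
      obtain ⟨hmode, hadmτ⟩ := hadm τ hτ0
      have hx := mem_poseDomain (hcl.vectorForm τ hτ0) hadmτ.posBar_mem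
      exact exists_deriv_storage_le_profileE hKc hKe hcl hτ0 hτs hadmτ (hL0 _) (hL _) (hlam _)
        (hΔ _ hmode _ hx) hε.le (hcon τ (Set.Ioo_subset_Icc_self hτ)).le
  rw [add_sub_cancel_left, mul_div_cancel₀ _ hη.ne'] at hdec
  have := storage_nonneg (σ.gce gd (t₀ + (a ^ 2 + 1) / (lamK Kc Ke * ε ^ 2)))
    (σ.gee (t₀ + (a ^ 2 + 1) / (lamK Kc Ke * ε ^ 2)))
  linarith

/-- Sublevel sets of the storage function that contain the ellipses are attractive. -/
theorem exists_time_storage_le [Finite Ψ] (hD : IsCompact D) (hKc : Kc.IsSymm) (hKe : Ke.IsSymm)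
    (hlamK : 0 < lamK Kc Ke) (hL0 : ∀ ψ, 0 ≤ L ψ) (hL : ∀ ψ, IsErrLipschitz D ξ (V ψ) (L ψ))
    (hlam : ∀ ψ, 0 < lamK Kc Ke - L ψ)
    (hΔ : ∀ ψ ∈ Φ, ∀ x ∈ poseDomain D,
      vnorm (V ψ (poseOf x) - μ ψ x) ≤ (G ψ).errBound D (B ψ) δ x)
    {l : ℝ} (hl : ∀ ψ ∈ Φ, ∀ gce gee : SE3, rotAngle gce.rot ≤ Real.pi / 2 →
      rotAngle gee.rot ≤ Real.pi / 2 → ∀ x ∈ poseDomain D,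
        profileE (G ψ) D (B ψ) δ (lamK Kc Ke) (L ψ) gce gee x ≤ 0 → storage gce gee < l)
    (a : ℝ) :
    ∃ T : ℝ, 0 ≤ T ∧ ∀ (s : ℝ → Ψ) (σ : Signals), IsRun D ξ V μ Kc Ke gd Φ s σ →
      ∀ t₀, 0 ≤ t₀ → vnorm (σ.err gd t₀) ≤ a → ∀ t, t₀ + T ≤ t →
        storage (σ.gce gd t) (σ.gee t) ≤ l := by
  obtain ⟨A, hA⟩ : ∃ A, A = max (a ^ 2) l := ⟨_, rfl⟩
  have hmargin : ∀ ψ, ∃ e : ℝ, 0 < e ∧ (ψ ∈ Φ → ∀ gce gee : SE3,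
      rotAngle gce.rot ≤ Real.pi / 2 → rotAngle gee.rot ≤ Real.pi / 2 → ∀ x ∈ poseDomain D,
        l ≤ storage gce gee → storage gce gee ≤ A →
          e ≤ profileE (G ψ) D (B ψ) δ (lamK Kc Ke) (L ψ) gce gee x) := by
    intro ψ
    by_cases hψ : ψ ∈ Φ
    · obtain ⟨e, he, h⟩ := exists_pos_le_profileE hD (G ψ) (B ψ) δ _ _ l A (hl ψ hψ)
      exact ⟨e, he, fun _ => h⟩
    · exact ⟨1, one_pos, fun h => absurd h hψ⟩
  choose f hf0 hf using hmargin
  obtain ⟨e, he, hef⟩ := exists_pos_le_of_finite f hf0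
  have hη : 0 < lamK Kc Ke * e ^ 2 := by positivity
  have hT : 0 ≤ (A - l) / (lamK Kc Ke * e ^ 2) :=
    div_nonneg (sub_nonneg.mpr (hA ▸ le_max_right _ _)) hη.le
  refine ⟨(A - l) / (lamK Kc Ke * e ^ 2), hT, fun s σ hrun t₀ ht₀ ha₀ t ht => ?_⟩
  obtain ⟨hcl, hadm⟩ := hrun
  have hS₀ : storage (σ.gce gd t₀) (σ.gee t₀) ≤ A :=
    ((hadm t₀ ht₀).2.storage_le ha₀).trans (hA ▸ le_max_left _ _)
  have hdecay : ∀ τ, t₀ ≤ τ → τ ∉ switchTimes s → ∀ r, 0 ≤ r →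
      r ≤ profileE (G (s τ)) D (B (s τ)) δ (lamK Kc Ke) (L (s τ))
        (σ.gce gd τ) (σ.gee τ) (σ.xBar τ) →
      ∃ d ≤ -(lamK Kc Ke * r ^ 2),
        HasDerivWithinAt (fun τ => storage (σ.gce gd τ) (σ.gee τ)) d (Set.Ici 0) τ := by
    intro τ hτ hτs r hr0 hr
    have hτ0 := ht₀.trans hτ
    obtain ⟨hmode, hadmτ⟩ := hadm τ hτ0
    have hx := mem_poseDomain (hcl.vectorForm τ hτ0) hadmτ.posBar_mem
    exact exists_deriv_storage_le_profileE hKc hKe hcl hτ0 hτs hadmτ (hL0 _) (hL _) (hlam _)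
      (hΔ _ hmode _ hx) hr0 hr
  -- The margin `e` is available only where `S ≤ A`. Above `A ≥ l` the state is outside every active
  -- ellipse, so `S` cannot grow past `A`.
  have hbound : ∀ τ, t₀ ≤ τ → storage (σ.gce gd τ) (σ.gee τ) ≤ A := by
    intro τ hτ
    refine le_of_deriv_nonpos_above (S := fun τ => storage (σ.gce gd τ) (σ.gee τ))
      hcl.continuousOn_storage hcl.switching ht₀ (fun r hr hrs hlr => ?_) hS₀ hτ
    obtain ⟨hmode, hadmr⟩ := hadm r (ht₀.trans hr)
    have hx := mem_poseDomain (hcl.vectorForm r (ht₀.trans hr)) hadmr.posBar_mem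
    have hE : 0 ≤ profileE (G (s r)) D (B (s r)) δ (lamK Kc Ke) (L (s r))
        (σ.gce gd r) (σ.gee r) (σ.xBar r) := by
      by_contra hneg
      rw [not_le] at hneg
      have h1 := hl _ hmode _ _ hadmr.angle_ce.le hadmr.angle_ee.le _ hx hneg.le
      have h2 : l ≤ A := hA ▸ le_max_right _ _
      linarith
    obtain ⟨d, hd, hd'⟩ := hdecay r hr hrs 0 le_rfl hE
    exact ⟨d, by simpa using hd, hd'⟩
  refine le_after_of_deriv_le_above (S := fun τ => storage (σ.gce gd τ) (σ.gee τ))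
    hcl.continuousOn_storage hcl.switching (A := A) ht₀ hη hT ?_ (fun τ hτ hτs hlτ => ?_) hS₀ ht
  · rw [mul_div_cancel₀ _ hη.ne']; linarith
  · obtain ⟨hmode, hadmτ⟩ := hadm τ (ht₀.trans hτ)
    have hx := mem_poseDomain (hcl.vectorForm τ (ht₀.trans hτ)) hadmτ.posBar_mem
    exact hdecay τ hτ hτs e he.le ((hef _).trans (hf _ hmode _ _ hadmτ.angle_ce.le
      hadmτ.angle_ee.le _ hx hlτ.le (hbound τ hτ)))

end convergence

end VisualPursuit

end

/-! ### Assembly of the claim -/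

theorem corollary1
    {Ω : Type*} [MeasurableSpace Ω] (P : Measure Ω) [IsProbabilityMeasure P]
    (D : Set (Fin 3 → ℝ)) (hD : IsCompact D)
    (Mbar : ℕ) (V : Fin Mbar → SE3 → Vec6) (G : Fin Mbar → GPModel)
    (hinput : ∀ ψ j, (G ψ).input j ∈ poseDomain D)
    (B : Fin Mbar → Vec6)
    (hB : ∀ ψ i, HasRKHSNorm (fun x y : poseDomain D => (G ψ).kernel x y)
      (fun x : poseDomain D => V ψ (poseOf x) i) (B ψ i))
    (noise : (ψ : Fin Mbar) → Fin (G ψ).M → I6 → Ω → ℝ)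
    (hmeas : ∀ ψ j i, Measurable (noise ψ j i))
    (hsub : ∀ ψ j i, HasSubgaussianMGF (noise ψ j i) ((G ψ).σn i ^ 2).toNNReal P)
    (hindep : ∀ ψ i, iIndepFun (fun j => noise ψ j i) P)
    (μ : Ω → Fin Mbar → Vec6 → Vec6)
    (hμ : ∀ ω ψ, μ ω ψ = (G ψ).mean
      (fun j i => V ψ (poseOf ((G ψ).input j)) i + noise ψ j i ω))
    (δ : ℝ) (hδ0 : 0 < δ) (hδ1 : δ < 1)
    (ξ : Fin 3 → ℝ) (hξ : vnorm ξ = 1) (gd : SE3)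
    (Kc Ke : Matrix I6 I6 ℝ) (hKc : Kc.IsSymm) (hKe : Ke.IsSymm) :
    -- the motion profiles are Lipschitz with respect to the estimation error
    (∀ ψ, ∃ L : ℝ, 0 < L ∧ IsErrLipschitz D ξ (V ψ) L) ∧
    ∃ good : Fin Mbar → Set Ω,
      (∀ ψ, MeasurableSet (good ψ) ∧ 1 - δ ^ 6 ≤ P.real (good ψ)) ∧
      ∀ L : Fin Mbar → ℝ, (∀ ψ, 0 ≤ L ψ) → (∀ ψ, IsErrLipschitz D ξ (V ψ) (L ψ)) →
        (∀ ψ, 0 < lamK Kc Ke - L ψ) →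
        -- the error is uniformly ultimately bounded
        (∀ ω, UniformlyUltimatelyBounded gd (IsRun D ξ V (μ ω) Kc Ke gd Set.univ)) ∧
        -- the storage function decreases strictly outside the ellipse
        (∀ ψ, ∀ ω ∈ good ψ, ∀ (s : ℝ → Fin Mbar) (σ : Signals),
          ClosedLoop V (μ ω) Kc Ke gd s σ →
          ∀ t, 0 ≤ t → t ∉ switchTimes s → s t = ψ → Admissible D ξ gd σ t →
            0 < profileE (G ψ) D (B ψ) δ (lamK Kc Ke) (L ψ) (σ.gce gd t) (σ.gee t) (σ.xBar t) →
            ∃ d : ℝ, d < 0 ∧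
              HasDerivWithinAt (fun τ => storage (σ.gce gd τ) (σ.gee τ)) d (Set.Ici 0) t) ∧
        -- convergence to the ellipses of the active modes `Φ`
        (∀ Φ : Set (Fin Mbar), ∀ ω, (∀ ψ ∈ Φ, ω ∈ good ψ) →
          -- every neighbourhood of the ellipse is reached within a uniform time
          (∀ ε : ℝ, 0 < ε → ∀ a : ℝ, 0 < a → ∃ T : ℝ, 0 ≤ T ∧
            ∀ (s : ℝ → Fin Mbar) (σ : Signals), IsRun D ξ V (μ ω) Kc Ke gd Φ s σ →
              ∀ t₀, 0 ≤ t₀ → vnorm (σ.err gd t₀) ≤ a →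
                ∃ t ∈ Set.Icc t₀ (t₀ + T),
                  profileE (G (s t)) D (B (s t)) δ (lamK Kc Ke) (L (s t))
                    (σ.gce gd t) (σ.gee t) (σ.xBar t) ≤ ε) ∧
          -- sublevel sets of the storage function that contain the ellipses are attractive
          (∀ ℓ : ℝ,
            (∀ ψ ∈ Φ, ∀ gce gee : SE3, rotAngle gce.rot ≤ Real.pi / 2 →
              rotAngle gee.rot ≤ Real.pi / 2 → ∀ x ∈ poseDomain D,
                profileE (G ψ) D (B ψ) δ (lamK Kc Ke) (L ψ) gce gee x ≤ 0 →
                  storage gce gee < ℓ) →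
            ∀ a : ℝ, 0 < a → ∃ T : ℝ, 0 ≤ T ∧
              ∀ (s : ℝ → Fin Mbar) (σ : Signals), IsRun D ξ V (μ ω) Kc Ke gd Φ s σ →
                ∀ t₀, 0 ≤ t₀ → vnorm (σ.err gd t₀) ≤ a →
                  ∀ t, t₀ + T ≤ t → storage (σ.gce gd t) (σ.gee t) ≤ ℓ)) := by
  have hnoise : ∀ ω ψ j i, (fun j i => V ψ (poseOf ((G ψ).input j)) i + noise ψ j i ω) j i
      = V ψ (poseOf ((G ψ).input j)) i + noise ψ j i ω := fun _ _ _ _ => rfl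
  refine ⟨fun ψ => ?_, fun ψ => confidenceEvent D (G ψ) δ (noise ψ), fun ψ =>
    ⟨measurableSet_confidenceEvent (hmeas ψ), ?_⟩, fun L hL0 hL hlam => ⟨fun ω => ?_, ?_, ?_⟩⟩
  · obtain ⟨C, hC, hCV⟩ := exists_lipschitz_vectorForm (hB ψ)
    exact exists_isErrLipschitz hξ hC hCV
  · exact le_measureReal_confidenceEvent (hinput ψ)
      -- Any of the six outputs would do, since they share one kernel.
      (gram_posSemidef (f := fun x => V ψ (poseOf x) (Sum.inl 0)) (hinput ψ) (hB ψ (Sum.inl 0)))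
      (hmeas ψ) (hsub ψ) (hindep ψ) hδ0 hδ1
  · have hex : ∀ ψ, ∃ C : ℝ, ∀ x ∈ poseDomain D,
        vnorm (V ψ (poseOf x) - μ ω ψ x) ≤ C := fun ψ => by
      rw [hμ]
      exact exists_bound_sub_mean (hB ψ) _
    choose C hC using hex
    refine uniformlyUltimatelyBounded_of_bound hKc hKe hL0 hL hlam (C := ∑ ψ, |C ψ|)
      fun ψ x hx => (hC ψ x hx).trans ((le_abs_self _).trans ?_)
    exact Finset.single_le_sum (f := fun ψ => |C ψ|) (fun _ _ => abs_nonneg _) (Finset.mem_univ ψ)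
  · intro ψ ω hω s σ hcl t ht hts hsψ hadm hE
    subst hsψ
    have hx := mem_poseDomain (hcl.vectorForm t ht) hadm.posBar_mem
    have hΔ := vnorm_sub_mean_le_errBound (hinput (s t)) (hB (s t)) (hnoise ω (s t)) hω hx
    rw [← hμ] at hΔ
    obtain ⟨d, hd, hd'⟩ := exists_deriv_storage_le_profileE hKc hKe hcl ht hts hadm (hL0 _) (hL _)
      (hlam _) hΔ hE.le le_rfl
    have hlamK : 0 < lamK Kc Ke := by linarith [hlam (s t), hL0 (s t)]
    exact ⟨d, hd.trans_lt (neg_lt_zero.mpr (mul_pos hlamK (pow_pos hE 2))), hd'⟩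
  · intro Φ ω hω
    have hΔ : ∀ ψ ∈ Φ, ∀ x ∈ poseDomain D,
        vnorm (V ψ (poseOf x) - μ ω ψ x) ≤ (G ψ).errBound D (B ψ) δ x := by
      intro ψ hψ x hx
      rw [hμ]
      exact vnorm_sub_mean_le_errBound (hinput ψ) (hB ψ) (hnoise ω ψ) (hω ψ hψ) hx
    -- Without modes there is no switching signal and nothing to show; positivity of `lamK` is
    -- available only from some mode.
    cases isEmpty_or_nonempty (Fin Mbar) with
    | inl hempty =>
      exact ⟨fun _ _ _ _ => ⟨0, le_rfl, fun s => isEmptyElim (s 0)⟩,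
        fun _ _ _ _ => ⟨0, le_rfl, fun s => isEmptyElim (s 0)⟩⟩
    | inr hne =>
      obtain ⟨ψ₀⟩ := hne
      have hlamK : 0 < lamK Kc Ke := by linarith [hlam ψ₀, hL0 ψ₀]
      exact ⟨fun ε hε a _ => exists_time_profileE_le hKc hKe hlamK hL0 hL hlam hΔ hε a,
        fun l hl a _ => exists_time_storage_le hD hKc hKe hlamK hL0 hL hlam hΔ hl a⟩
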